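/- Let $p(x,y)\in\mathbb C\{x,y\}$ be a convergent power series with $p(0,0)=0$ such that the lowest power of $y$ occurring in $p$ is $y^r$, with coefficient $1$ (that is, $p(0,y)=y^r+(\text{higher powers of }y)$). Let $h(x)\in\mathbb C[x]$ be a polynomial of degree $m$ with $h(0)=0$ (so $h\neq 0$ and $m\ge 1$). A Puiseux factor of $p$ is a factor $y+\varphi(x^{1/n})$ of $p$, where $n\ge 1$, $\varphi$ is a convergent power series in one variable and $\varphi(0)=0$; that is, $y+\varphi(t)$ divides $p(t^n,y)$ in $\mathbb C\{t,y\}$. We say that it has the form $$y+h(x)+(\text{higher terms})\tag{$*$}$$ if $\varphi(x^{1/n})-h(x)$ involves only monomials $x^\alpha$, $\alpha\in\frac1n\mathbb Z$, with $\alpha>m$. Then the following hold. 1. If $p$ is irreducible in $\mathbb C\{x,y\}$ and one Puiseux factor of $p$ has the form $(*)$, then so does every Puiseux factor of $p$. 2. Every Puiseux factor of $p$ has the form $(*)$ if and only if one can write $$p(x,y)=(y+h(x))^r+\sum_{i+j/m>r}a_{ij}\,(y+h(x))^i x^j$$ with $a_{ij}\in\mathbb C$ the coefficients of a convergent power series in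 two variables. 3. The implicit function theorem applies at the origin to the equation $$\frac1{r!}\frac{\partial^{r-1}p}{\partial y^{r-1}}=0$$ (the left side vanishes at $(0,0)$ and its $y$-derivative does not), so the equation has a unique power series solution $y=g(x)$ with $g(0)=0$, and $g$ is convergent. If every Puiseux factor of $p$ has the form $(*)$, then $g(x)=-h(x)-(\text{higher terms})$, where the higher terms form a convergent power series in $x$ divisible by $x^{m+1}$. 4. If $p$ is a Weierstrass polynomial in $y$ of degree $r$ and every Puiseux factor of $p$ has the form $(*)$, then $$\frac1{r!}\frac{\partial^{r-1}p}{\partial y^{r-1}}=y+h(x)+(\text{higher terms}),$$ where the higher terms form a convergent power series in $x$ divisible by $x^{m+1}$. -/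

import Mathlib

noncomputable section

/-- A formal power series over `ℂ` is convergent if it converges absolutely on some polydisc
`{|x_s| ≤ ρ}` of positive radius around the origin. -/
def IsConvergentSeries {σ : Type*} (f : MvPowerSeries σ ℂ) : Prop :=
  ∃ ρ : ℝ, 0 < ρ ∧ Summable fun d : σ →₀ ℕ => ‖MvPowerSeries.coeff d f‖ * ρ ^ d.degree

theorem isConvergentSeries_mono {σ : Type*} {f : MvPowerSeries σ ℂ} {ρ ρ' : ℝ} (h0 : 0 ≤ ρ)
    (h : ρ ≤ ρ')
    (hf : Summable fun d : σ →₀ ℕ => ‖MvPowerSeries.coeff d f‖ * ρ' ^ d.degree) :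
    Summable fun d : σ →₀ ℕ => ‖MvPowerSeries.coeff d f‖ * ρ ^ d.degree :=
  Summable.of_nonneg_of_le (fun d => by positivity) (fun d => by gcongr) hf

theorem isConvergentSeries_algebraMap {σ : Type*} (c : ℂ) :
    IsConvergentSeries (algebraMap ℂ (MvPowerSeries σ ℂ) c) := by
  classical
  refine ⟨1, one_pos, summable_of_ne_finset_zero (s := {0}) ?_⟩
  intro d hd
  rw [MvPowerSeries.algebraMap_apply, MvPowerSeries.coeff_C, if_neg (by simpa using hd)]
  simp

theorem IsConvergentSeries.add {σ : Type*} {f g : MvPowerSeries σ ℂ}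
    (hf : IsConvergentSeries f) (hg : IsConvergentSeries g) : IsConvergentSeries (f + g) := by
  obtain ⟨a, ha, hfa⟩ := hf
  obtain ⟨b, hb, hgb⟩ := hg
  have hm : 0 < min a b := lt_min ha hb
  refine ⟨min a b, hm, Summable.of_nonneg_of_le (fun d => by positivity) (fun d => ?_)
    ((isConvergentSeries_mono hm.le (min_le_left a b) hfa).add
      (isConvergentSeries_mono hm.le (min_le_right a b) hgb))⟩
  rw [← add_mul, map_add]
  gcongr
  exact norm_add_le _ _

theorem IsConvergentSeries.mul {σ : Type*} {f g : MvPowerSeries σ ℂ}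
    (hf : IsConvergentSeries f) (hg : IsConvergentSeries g) : IsConvergentSeries (f * g) := by
  classical
  obtain ⟨a, ha, hfa⟩ := hf
  obtain ⟨b, hb, hgb⟩ := hg
  have hm : 0 < min a b := lt_min ha hb
  set F : (σ →₀ ℕ) → ℝ := fun d => ‖MvPowerSeries.coeff d f‖ * min a b ^ d.degree with hF
  set G : (σ →₀ ℕ) → ℝ := fun d => ‖MvPowerSeries.coeff d g‖ * min a b ^ d.degree with hG
  have sF : Summable F := isConvergentSeries_mono hm.le (min_le_left a b) hfa
  have sG : Summable G := isConvergentSeries_mono hm.le (min_le_right a b) hgb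
  have pF : 0 ≤ F := fun d => mul_nonneg (norm_nonneg _) (pow_nonneg hm.le _)
  have pG : 0 ≤ G := fun d => mul_nonneg (norm_nonneg _) (pow_nonneg hm.le _)
  have key : Summable fun d : σ →₀ ℕ => ∑ k ∈ Finset.HasAntidiagonal.antidiagonal d, F k.1 * G k.2 :=
    summable_sum_mul_antidiagonal_of_summable_mul (sF.mul_of_nonneg sG pF pG)
  have e : ∀ d : σ →₀ ℕ, ∑ k ∈ Finset.HasAntidiagonal.antidiagonal d, F k.1 * G k.2 =
      (∑ k ∈ Finset.HasAntidiagonal.antidiagonal d, ‖MvPowerSeries.coeff k.1 f * MvPowerSeries.coeff k.2 g‖) *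
        min a b ^ d.degree := by
    intro d
    rw [Finset.sum_mul]
    refine Finset.sum_congr rfl fun k hk => ?_
    have hd : d.degree = k.1.degree + k.2.degree := by
      rw [← Finset.HasAntidiagonal.mem_antidiagonal.mp hk, map_add]
    simp only [hF, hG]
    rw [hd, pow_add, norm_mul]
    ring
  refine ⟨min a b, hm, Summable.of_nonneg_of_le
    (fun d => mul_nonneg (norm_nonneg _) (pow_nonneg hm.le _)) (fun d => ?_) key⟩
  rw [e d, MvPowerSeries.coeff_mul]
  exact mul_le_mul_of_nonneg_right (norm_sum_le _ _) (pow_nonneg hm.le _)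

/-- The ring of convergent power series `ℂ{x_s : s ∈ σ}`. -/
def convergentSeries (σ : Type*) : Subalgebra ℂ (MvPowerSeries σ ℂ) where
  carrier := {f | IsConvergentSeries f}
  mul_mem' := IsConvergentSeries.mul
  add_mem' := IsConvergentSeries.add
  algebraMap_mem' := isConvergentSeries_algebraMap

/-- The ring `ℂ{x, y}`; the variable `x` has index `0` and the variable `y` has index `1`. -/
abbrev ConvXY : Type := convergentSeries (Fin 2)

/-- The variable `x` of `ℂ[[x, y]]`. -/
abbrev varX : MvPowerSeries (Fin 2) ℂ := MvPowerSeries.X 0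

/-- The variable `y` of `ℂ[[x, y]]`. -/
abbrev varY : MvPowerSeries (Fin 2) ℂ := MvPowerSeries.X 1

/-- A one-variable series `φ`, regarded as the series `φ(x)` in `ℂ[[x, y]]`. -/
def inX (φ : PowerSeries ℂ) : MvPowerSeries (Fin 2) ℂ := PowerSeries.subst varX φ

/-- The polynomial `h`, regarded as the series `h(x)` in `ℂ[[x, y]]`. -/
def polyInX (h : Polynomial ℂ) : MvPowerSeries (Fin 2) ℂ := Polynomial.aeval varX h

/-- `y + φ(x^{1/n})` is a Puiseux factor of `p`: the series `φ` is holomorphic with `φ(0) = 0`,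
and `y + φ(x^{1/n})` divides `p`. In terms of `t = x^{1/n}` this says that `y + φ(t)` divides
`p(t^n, y)` in the ring `ℂ{t, y}` (whose variables are again indexed by `0` and `1`).
As `y + φ(t)` is prime in `ℂ{t, y}`, these are exactly the factors that occur in the factorization
`p = u · ∏ᵢ (y + φᵢ(x^{1/rᵢ}))`, `u(0, 0) ≠ 0`, into Puiseux series. -/
structure IsPuiseuxFactor (p : ConvXY) (n : ℕ) (φ : PowerSeries ℂ) : Prop where
  pos : 0 < n
  convergent : IsConvergentSeries φ
  vanish : PowerSeries.constantCoeff φ = 0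
  dvd : ∃ q : ConvXY,
    MvPowerSeries.subst ![varX ^ n, varY] (p : MvPowerSeries (Fin 2) ℂ) = (varY + inX φ) * q

/-- `y + φ(x^{1/n})` has the form `y + h(x) + (higher terms)`, where `h` has degree `m` and the
higher terms are terms `c x^α` with `α ∈ (1/n)ℤ`, `α > m`. In terms of `t = x^{1/n}` this says that
`φ(t) - h(t^n)` has only terms `c t^k` with `k > n m`. -/
def HasLeadingPart (h : Polynomial ℂ) (m n : ℕ) (φ : PowerSeries ℂ) : Prop :=
  (PowerSeries.X : PowerSeries ℂ) ^ (n * m + 1) ∣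
    φ - Polynomial.aeval ((PowerSeries.X : PowerSeries ℂ) ^ n) h

/-- The lowest power of `y` in `p` is `y^r`, with coefficient `1`. -/
def HasLowestYPower (p : ConvXY) (r : ℕ) : Prop :=
  MvPowerSeries.coeff (Finsupp.single 1 r) (p : MvPowerSeries (Fin 2) ℂ) = 1 ∧
    ∀ k < r, MvPowerSeries.coeff (Finsupp.single 1 k) (p : MvPowerSeries (Fin 2) ℂ) = 0

/-- `p` is a Weierstrass polynomial in `y` of degree `r`:
`p = y^r + ∑_{i<r} aᵢ(x) y^i` with `aᵢ ∈ ℂ{x}` and `aᵢ(0) = 0`. -/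
def IsWeierstrassPolynomial (p : ConvXY) (r : ℕ) : Prop :=
  ∃ a : Fin r → PowerSeries ℂ,
    (∀ i, IsConvergentSeries (a i) ∧ PowerSeries.constantCoeff (a i) = 0) ∧
    (p : MvPowerSeries (Fin 2) ℂ) = varY ^ r + ∑ i : Fin r, inX (a i) * varY ^ (i : ℕ)

/-- The normalized derivative `(1/r!) ∂^{r-1}p/∂y^{r-1}`, for `r ≥ 1`. -/
def normalizedYDeriv (p : ConvXY) (r : ℕ) : MvPowerSeries (Fin 2) ℂ :=
  ((r.factorial : ℂ)⁻¹) •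
    (fun f : MvPowerSeries (Fin 2) ℂ => MvPowerSeries.pderiv ℂ 1 f)^[r - 1]
      (p : MvPowerSeries (Fin 2) ℂ)

end

/-! By the factor theorem, `y + φ(x^{1/n})` is a Puiseux factor of `p` exactly when `p(t^n, -φ(t)) =
0` (`isPuiseuxFactor_iff`). The shear `P(x, y) = p(x, y - h(x))` turns such a root into the root
`ψ(t) = h(t^n) - φ(t)` of `P`, and the form (*) becomes the condition that `ψ` has order greater
than `n m` (`hasLeadingPart_iff_puiseuxRootsOrderGT`).

The heart of the proof is that all Puiseux roots of `P` have this order if and only if every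
monomial `x^i y^j` of `P` with `j < r` has `i > m (r - j)`. From roots to monomials, one root at a
time is divided out; its existence is the Newton-Puiseux theorem `exists_puiseux_root`. In the other
direction, the term `y^r` is compared with the orders of the remaining terms. Shearing back, the
condition on monomials is the expansion in (2).

For (3), write `r = k + 1`. The `k`-th `y`-derivative commutes with the shear, and on `y = 0` it
sees only the coefficients of `x^j y^k` in `P`, which vanish for `j ≤ m`. Its normalization has
`y`-derivative `1` at the origin, so Hadamard's lemma bounds the order of `g + h` from below by `m +
1`. For a Weierstrass polynomial the normalized derivative is `y + s(x)`, so `s = -g`, which gives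
(4).

For (1), the product of the distinct conjugates `y + φ(ζt)`, `ζ^n = 1`, divides `p(t^n, y)` and is
invariant under `t ↦ ζt`. Product and quotient therefore both descend to `ℂ{x, y}`, and
irreducibility makes the quotient a unit. Every other Puiseux factor is thus a conjugate of the
given one, up to ramification, and conjugation fixes `h(t^n)`. -/

open scoped ENNReal NNReal

/-! ### Convergence through weighted norms -/

/-- The weighted `ℓ¹` norm `∑ |f_d| ρ^|d|` of a power series. -/
noncomputable def wnorm {σ : Type*} (ρ : ℝ≥0) (f : MvPowerSeries σ ℂ) : ℝ≥0∞ :=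
  ∑' d : σ →₀ ℕ, ‖MvPowerSeries.coeff d f‖ₑ * (ρ : ℝ≥0∞) ^ d.degree

section wnorm

variable {σ τ : Type*}

theorem isConvergentSeries_iff_wnorm {f : MvPowerSeries σ ℂ} :
    IsConvergentSeries f ↔ ∃ ρ : ℝ≥0, 0 < ρ ∧ wnorm ρ f ≠ ∞ := by
  have key : ∀ ρ : ℝ≥0, wnorm ρ f ≠ ∞ ↔
      Summable fun d : σ →₀ ℕ => ‖MvPowerSeries.coeff d f‖ * (ρ : ℝ) ^ d.degree := by
    intro ρ
    have h1 : wnorm ρ f =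
        ∑' d : σ →₀ ℕ, ((‖MvPowerSeries.coeff d f‖₊ * ρ ^ d.degree : ℝ≥0) : ℝ≥0∞) := by
      unfold wnorm
      refine tsum_congr fun d => ?_
      push_cast
      rfl
    rw [h1, ENNReal.tsum_coe_ne_top_iff_summable, ← NNReal.summable_coe]
    refine summable_congr fun d => ?_
    push_cast
    rfl
  constructor
  · rintro ⟨ρ, hρ, h⟩
    lift ρ to ℝ≥0 using hρ.le
    exact ⟨ρ, by exact_mod_cast hρ, (key ρ).2 h⟩
  · rintro ⟨ρ, hρ, h⟩
    exact ⟨ρ, by exact_mod_cast hρ, (key ρ).1 h⟩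

theorem wnorm_mono {ρ ρ' : ℝ≥0} (h : ρ ≤ ρ') (f : MvPowerSeries σ ℂ) :
    wnorm ρ f ≤ wnorm ρ' f := by
  unfold wnorm
  gcongr

/-- Values in `ℝ≥0∞` allow free rearrangement of the double sum; summability never has to be
checked. -/
theorem wnorm_mul_le (ρ : ℝ≥0) (f g : MvPowerSeries σ ℂ) :
    wnorm ρ (f * g) ≤ wnorm ρ f * wnorm ρ g := by
  classical
  set F : (σ →₀ ℕ) → ℝ≥0∞ := fun d => ‖MvPowerSeries.coeff d f‖ₑ * (ρ : ℝ≥0∞) ^ d.degree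
  set G : (σ →₀ ℕ) → ℝ≥0∞ := fun d => ‖MvPowerSeries.coeff d g‖ₑ * (ρ : ℝ≥0∞) ^ d.degree
  have h1 : wnorm ρ f * wnorm ρ g = ∑' d : σ →₀ ℕ, ∑ k ∈ Finset.HasAntidiagonal.antidiagonal d, F k.1 * G k.2 := by
    have : wnorm ρ f * wnorm ρ g = ∑' k : (σ →₀ ℕ) × (σ →₀ ℕ), F k.1 * G k.2 := by
      rw [ENNReal.tsum_prod (f := fun a b => F a * G b)]
      simp_rw [ENNReal.tsum_mul_left, ENNReal.tsum_mul_right]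
      rfl
    rw [this, ← Finset.HasAntidiagonal.sigmaAntidiagonalEquivProd.tsum_eq, ENNReal.tsum_sigma']
    refine tsum_congr fun d => ?_
    rw [tsum_fintype]
    exact Finset.sum_coe_sort (Finset.HasAntidiagonal.antidiagonal d) fun k => F k.1 * G k.2
  rw [h1]
  unfold wnorm
  refine ENNReal.tsum_le_tsum fun d => ?_
  rw [MvPowerSeries.coeff_mul]
  calc _ ≤ (∑ k ∈ Finset.HasAntidiagonal.antidiagonal d, ‖MvPowerSeries.coeff k.1 f * MvPowerSeries.coeff k.2 g‖ₑ)
        * (ρ : ℝ≥0∞) ^ d.degree := by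
        gcongr
        exact enorm_sum_le _ _
    _ = _ := by
        rw [Finset.sum_mul]
        refine Finset.sum_congr rfl fun k hk => ?_
        have hd : d.degree = k.1.degree + k.2.degree := by
          rw [← Finset.HasAntidiagonal.mem_antidiagonal.mp hk, map_add]
        simp only [F, G]
        rw [hd, pow_add, enorm_mul]
        ring

theorem wnorm_one_le (ρ : ℝ≥0) : wnorm ρ (1 : MvPowerSeries σ ℂ) ≤ 1 := by
  classical
  unfold wnorm
  rw [tsum_eq_single 0]
  · simp
  · intro d hd
    simp [MvPowerSeries.coeff_one, hd]

theorem wnorm_pow_le (ρ : ℝ≥0) (f : MvPowerSeries σ ℂ) (n : ℕ) :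
    wnorm ρ (f ^ n) ≤ wnorm ρ f ^ n := by
  induction n with
  | zero => simpa using wnorm_one_le ρ
  | succ n ih =>
    rw [pow_succ, pow_succ]
    exact (wnorm_mul_le _ _ _).trans (by gcongr)

theorem wnorm_prod_le {ι : Type*} (ρ : ℝ≥0) (s : Finset ι) (f : ι → MvPowerSeries σ ℂ) :
    wnorm ρ (∏ i ∈ s, f i) ≤ ∏ i ∈ s, wnorm ρ (f i) := by
  classical
  induction s using Finset.induction_on with
  | empty => simpa using wnorm_one_le ρ
  | insert a s ha ih =>
    rw [Finset.prod_insert ha, Finset.prod_insert ha]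
    exact (wnorm_mul_le _ _ _).trans (by gcongr)

theorem wnorm_X (ρ : ℝ≥0) (s : σ) : wnorm ρ (MvPowerSeries.X s : MvPowerSeries σ ℂ) = ρ := by
  classical
  unfold wnorm
  rw [tsum_eq_single (Finsupp.single s 1)]
  · simp
  · intro d hd
    simp [MvPowerSeries.coeff_X, hd]

theorem wnorm_subst_le {a : σ → MvPowerSeries τ ℂ} (ha : MvPowerSeries.HasSubst a) (ρ : ℝ≥0)
    (f : MvPowerSeries σ ℂ) :
    wnorm ρ (MvPowerSeries.subst a f) ≤
      ∑' d : σ →₀ ℕ, ‖MvPowerSeries.coeff d f‖ₑ * d.prod fun s e => wnorm ρ (a s) ^ e := by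
  have h1 : ∀ e : τ →₀ ℕ, ‖MvPowerSeries.coeff e (MvPowerSeries.subst a f)‖ₑ ≤
      ∑' d : σ →₀ ℕ, ‖MvPowerSeries.coeff d f‖ₑ *
        ‖MvPowerSeries.coeff e (d.prod fun s e => a s ^ e)‖ₑ := by
    intro e
    rw [MvPowerSeries.coeff_subst ha, finsum_eq_sum _ (MvPowerSeries.coeff_subst_finite ha f e)]
    refine (enorm_sum_le _ _).trans ?_
    simp_rw [smul_eq_mul, enorm_mul]
    exact ENNReal.sum_le_tsum _
  calc wnorm ρ (MvPowerSeries.subst a f)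
      ≤ ∑' e : τ →₀ ℕ, ∑' d : σ →₀ ℕ, ‖MvPowerSeries.coeff d f‖ₑ *
        ‖MvPowerSeries.coeff e (d.prod fun s e => a s ^ e)‖ₑ * (ρ : ℝ≥0∞) ^ e.degree := by
        unfold wnorm
        refine ENNReal.tsum_le_tsum fun e => ?_
        rw [ENNReal.tsum_mul_right]
        gcongr
        exact h1 e
    _ = ∑' d : σ →₀ ℕ, ‖MvPowerSeries.coeff d f‖ₑ * wnorm ρ (d.prod fun s e => a s ^ e) := by
        rw [ENNReal.tsum_comm]
        unfold wnorm
        simp_rw [mul_assoc, ENNReal.tsum_mul_left]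
    _ ≤ _ := by
        refine ENNReal.tsum_le_tsum fun d => ?_
        gcongr
        refine (wnorm_prod_le _ _ _).trans ?_
        exact Finset.prod_le_prod' fun s _ => wnorm_pow_le _ _ _

/-- Every exponent that occurs has degree at least one, so shrinking the radius by `ε` gains a
factor `ε` in each term. Norms of series vanishing at the origin can thus be made arbitrarily small.
-/
theorem wnorm_le_of_constantCoeff_zero {f : MvPowerSeries σ ℂ}
    (hf : MvPowerSeries.constantCoeff f = 0) (ε ρ : ℝ≥0) (hε : ε ≤ 1) :
    wnorm (ε * ρ) f ≤ ε * wnorm ρ f := by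
  unfold wnorm
  rw [← ENNReal.tsum_mul_left]
  refine ENNReal.tsum_le_tsum fun d => ?_
  rcases eq_or_ne d 0 with rfl | hd
  · simp [hf]
  · have h1 : d.degree ≠ 0 := by rwa [Ne, Finsupp.degree_eq_zero_iff]
    have h2 : (ε : ℝ≥0∞) ^ d.degree ≤ ε := by
      have := pow_le_of_le_one (zero_le) hε h1
      exact_mod_cast this
    rw [ENNReal.coe_mul, mul_pow, ← mul_assoc, mul_comm _ ((ε : ℝ≥0∞) ^ _), mul_assoc]
    gcongr

theorem exists_pos_mul_le (K : ℝ≥0∞) (hK : K ≠ ∞) {r : ℝ≥0} (hr : 0 < r) :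
    ∃ ε : ℝ≥0, 0 < ε ∧ ε ≤ 1 ∧ (ε : ℝ≥0∞) * K ≤ r := by
  lift K to ℝ≥0 using hK
  refine ⟨min 1 (r / (K + 1)), lt_min one_pos (by positivity), min_le_left _ _, ?_⟩
  norm_cast
  calc min 1 (r / (K + 1)) * K ≤ r / (K + 1) * (K + 1) := by
        gcongr
        · exact min_le_right _ _
        · exact le_self_add
    _ = r := by field_simp

theorem IsConvergentSeries.exists_wnorm_le {f : MvPowerSeries σ ℂ} (hf : IsConvergentSeries f)
    (h0 : MvPowerSeries.constantCoeff f = 0) {R : ℝ≥0} (hR : 0 < R) :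
    ∃ ρ : ℝ≥0, 0 < ρ ∧ wnorm ρ f ≤ R := by
  obtain ⟨ρ, hρ, h⟩ := isConvergentSeries_iff_wnorm.1 hf
  obtain ⟨ε, hε, hε1, hεK⟩ := exists_pos_mul_le _ h hR
  exact ⟨ε * ρ, by positivity, (wnorm_le_of_constantCoeff_zero h0 _ _ hε1).trans hεK⟩

theorem IsConvergentSeries.exists_wnorm_le_of_finite [Finite σ] {a : σ → MvPowerSeries τ ℂ}
    (ha : ∀ s, IsConvergentSeries (a s)) (h0 : ∀ s, MvPowerSeries.constantCoeff (a s) = 0)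
    {R : ℝ≥0} (hR : 0 < R) : ∃ ρ : ℝ≥0, 0 < ρ ∧ ∀ s, wnorm ρ (a s) ≤ R := by
  choose ρ hρ h using fun s => (ha s).exists_wnorm_le (h0 s) hR
  cases isEmpty_or_nonempty σ
  · exact ⟨1, one_pos, fun s => isEmptyElim s⟩
  · obtain ⟨s, hs⟩ := Finite.exists_min ρ
    exact ⟨ρ s, hρ s, fun t => (wnorm_mono (hs t) _).trans (h t)⟩

/-- If `f` has finite norm at radius `R`, choose `ρ` so small that each substituted series has norm
at most `R`; the norm of `f` at `R` then majorizes that of the composite at `ρ`. -/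
theorem IsConvergentSeries.subst [Finite σ] {f : MvPowerSeries σ ℂ} (hf : IsConvergentSeries f)
    {a : σ → MvPowerSeries τ ℂ} (ha : ∀ s, IsConvergentSeries (a s))
    (h0 : ∀ s, MvPowerSeries.constantCoeff (a s) = 0) :
    IsConvergentSeries (MvPowerSeries.subst a f) := by
  obtain ⟨R, hR, h⟩ := isConvergentSeries_iff_wnorm.1 hf
  obtain ⟨ρ, hρ, hρa⟩ := IsConvergentSeries.exists_wnorm_le_of_finite ha h0 hR
  refine isConvergentSeries_iff_wnorm.2 ⟨ρ, hρ, ne_top_of_le_ne_top h ?_⟩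
  refine (wnorm_subst_le (MvPowerSeries.hasSubst_of_constantCoeff_zero h0) ρ f).trans ?_
  unfold wnorm
  refine ENNReal.tsum_le_tsum fun d => ?_
  gcongr
  rw [Finsupp.degree_apply, ← Finset.prod_pow_eq_pow_sum]
  exact Finset.prod_le_prod' fun s _ => pow_le_pow_left' (hρa s) _

theorem IsConvergentSeries.X (s : σ) : IsConvergentSeries (MvPowerSeries.X s : MvPowerSeries σ ℂ) :=
  isConvergentSeries_iff_wnorm.2 ⟨1, one_pos, by simp [wnorm_X]⟩

theorem IsConvergentSeries.C (c : ℂ) : IsConvergentSeries (MvPowerSeries.C c : MvPowerSeries σ ℂ) :=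
  isConvergentSeries_algebraMap c

theorem IsConvergentSeries.pow {f : MvPowerSeries σ ℂ} (hf : IsConvergentSeries f) (n : ℕ) :
    IsConvergentSeries (f ^ n) := (convergentSeries σ).pow_mem hf n

theorem IsConvergentSeries.neg {f : MvPowerSeries σ ℂ} (hf : IsConvergentSeries f) :
    IsConvergentSeries (-f) := (convergentSeries σ).neg_mem hf

theorem IsConvergentSeries.sub {f g : MvPowerSeries σ ℂ} (hf : IsConvergentSeries f)
    (hg : IsConvergentSeries g) : IsConvergentSeries (f - g) := (convergentSeries σ).sub_mem hf hg

theorem IsConvergentSeries.smul {f : MvPowerSeries σ ℂ} (hf : IsConvergentSeries f) (c : ℂ) :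
    IsConvergentSeries (c • f) := (convergentSeries σ).smul_mem hf c

theorem IsConvergentSeries.aeval {f : MvPowerSeries σ ℂ} (hf : IsConvergentSeries f)
    (h : Polynomial ℂ) : IsConvergentSeries (Polynomial.aeval f h) := by
  have := (Polynomial.aeval (⟨f, hf⟩ : convergentSeries σ) h).2
  rwa [← Subalgebra.coe_val, ← Polynomial.aeval_algHom_apply] at this

/-- A series whose coefficients are, along an injection of exponents that at most
enlarges degrees by a factor, those of a convergent series is convergent. -/
theorem IsConvergentSeries.of_coeff_le {f : MvPowerSeries σ ℂ} {g : MvPowerSeries τ ℂ}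
    (hf : IsConvergentSeries f) (j : (τ →₀ ℕ) → (σ →₀ ℕ)) (hj : Function.Injective j)
    (n : ℕ) (hn : ∀ d, (j d).degree ≤ n * d.degree + n)
    (hc : ∀ d, ‖MvPowerSeries.coeff d g‖ ≤ 2 ^ d.degree * ‖MvPowerSeries.coeff (j d) f‖) :
    IsConvergentSeries g := by
  obtain ⟨ρ, hρ, h⟩ := hf
  set r : ℝ := min ρ 1
  have hr : 0 < r := lt_min hρ one_pos
  have hr1 : r ≤ 1 := min_le_right _ _
  have h' := isConvergentSeries_mono hr.le (min_le_left ρ 1) h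
  -- The factor `1/2` absorbs `2^|d|`, the power `r^n` pays for degrees growing like `n|d|`, and the
  -- additive `n` costs only the constant `(r^n)⁻¹`.
  refine ⟨r ^ n / 2, by positivity, ?_⟩
  refine Summable.of_nonneg_of_le (fun d => by positivity) (fun d => ?_)
    ((h'.comp_injective hj).mul_left ((r ^ n)⁻¹))
  have h1 : r ^ (n * d.degree + n) ≤ r ^ (j d).degree := pow_le_pow_of_le_one hr.le hr1 (hn d)
  have h2 : (r ^ n / 2) ^ d.degree = (r ^ n)⁻¹ * r ^ (n * d.degree + n) * (2 ^ d.degree)⁻¹ := by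
    rw [pow_add, pow_mul, div_pow]
    field_simp
  calc _ ≤ (2 ^ d.degree * ‖MvPowerSeries.coeff (j d) f‖) *
        ((r ^ n)⁻¹ * r ^ (n * d.degree + n) * (2 ^ d.degree)⁻¹) := by
        rw [h2]; gcongr; exact hc d
    _ = (r ^ n)⁻¹ * (‖MvPowerSeries.coeff (j d) f‖ * r ^ (n * d.degree + n)) := by
        field_simp
    _ ≤ _ := by
        simp only [Function.comp]
        gcongr

theorem IsConvergentSeries.of_X_pow_mul {f : MvPowerSeries σ ℂ} {s : σ} {n : ℕ}
    (hf : IsConvergentSeries (MvPowerSeries.X s ^ n * f)) : IsConvergentSeries f := by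
  refine hf.of_coeff_le (fun d => Finsupp.single s n + d) (add_right_injective _) (n + 1)
    (fun d => ?_) (fun d => ?_)
  · rw [map_add, Finsupp.degree_single]
    nlinarith
  · rw [MvPowerSeries.X_pow_eq, MvPowerSeries.coeff_add_monomial_mul, one_mul]
    exact le_mul_of_one_le_left (norm_nonneg _) (one_le_pow₀ one_le_two)

theorem IsConvergentSeries.pderiv {f : MvPowerSeries σ ℂ} (hf : IsConvergentSeries f) (s : σ) :
    IsConvergentSeries (MvPowerSeries.pderiv ℂ s f) := by
  refine hf.of_coeff_le (fun d => d + Finsupp.single s 1) (add_left_injective _) 1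
    (fun d => ?_) (fun d => ?_)
  · rw [map_add, Finsupp.degree_single]
    omega
  · rw [MvPowerSeries.coeff_pderiv, norm_mul, mul_comm]
    gcongr
    have h1 : d s ≤ d.degree := Finsupp.le_degree s d
    have h2 : d.degree + 1 ≤ 2 ^ d.degree := Nat.lt_two_pow_self
    calc ‖(d s : ℂ) + 1‖ = ((d s + 1 : ℕ) : ℝ) := by
          rw [← Nat.cast_succ, Complex.norm_natCast]
      _ ≤ ((2 ^ d.degree : ℕ) : ℝ) := by exact_mod_cast (by omega)
      _ = _ := by push_cast; rfl

end wnorm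

/-! ### The chain rule -/

section chainRule

open scoped MvPowerSeries.WithPiTopology

theorem continuous_pderiv {R υ : Type*} [CommRing R] [TopologicalSpace R] [IsTopologicalRing R]
    (s : υ) : Continuous (MvPowerSeries.pderiv R s : MvPowerSeries υ R → MvPowerSeries υ R) := by
  refine continuous_pi fun d => ?_
  exact (MvPowerSeries.WithPiTopology.continuous_coeff R (d + Finsupp.single s 1)).mul
    continuous_const

/-- The chain rule for substitution into formal power series. -/
theorem pderiv_subst {R σ τ : Type*} [CommRing R] [Fintype σ] [DecidableEq σ]
    {a : σ → MvPowerSeries τ R}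
    (ha : MvPowerSeries.HasSubst a) (s : τ) (f : MvPowerSeries σ R) :
    MvPowerSeries.pderiv R s (MvPowerSeries.subst a f) =
      ∑ t, MvPowerSeries.subst a (MvPowerSeries.pderiv R t f) * MvPowerSeries.pderiv R s (a t) := by
  -- With the discrete topology on coefficients both sides are continuous in `f`, so it suffices to
  -- compare them on the dense set of polynomials.
  let _ : UniformSpace R := ⊥
  have _ : DiscreteUniformity R := ⟨rfl⟩
  have hS := MvPowerSeries.continuous_subst (R := R) ha
  refine congrFun (DenseRange.equalizer
    (MvPowerSeries.WithPiTopology.denseRange_toMvPowerSeries (σ := σ) (R := R))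
    (g := fun f : MvPowerSeries σ R => MvPowerSeries.pderiv R s (MvPowerSeries.subst a f))
    (h := fun f : MvPowerSeries σ R => ∑ t, MvPowerSeries.subst a (MvPowerSeries.pderiv R t f) *
      MvPowerSeries.pderiv R s (a t)) ((continuous_pderiv s).comp hS)
    (continuous_finsetSum _ fun t _ => (hS.comp (continuous_pderiv t)).mul continuous_const) ?_) f
  funext p
  simp only [Function.comp, MvPowerSeries.pderiv_coe, MvPowerSeries.subst_coe]
  induction p using MvPolynomial.induction_on with
  | C r => simp [← MvPowerSeries.c_eq_algebraMap]
  | add p q hp hq => simp [hp, hq, add_mul, Finset.sum_add_distrib]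
  | mul_X p i hp =>
    simp only [map_mul, Derivation.leibniz, MvPolynomial.aeval_X, smul_eq_mul, hp, map_add,
      add_mul, Finset.sum_add_distrib, MvPolynomial.pderiv_X, Finset.mul_sum]
    congr 1
    · rw [Finset.sum_eq_single i]
      · simp
      · intro b _ hb
        simp [hb.symm]
      · simp
    · exact Finset.sum_congr rfl fun t _ => by ring

end chainRule

/-! ### Substitution of a pair of series -/

section pair

variable {τ υ : Type*} {u v : MvPowerSeries τ ℂ}

theorem hasSubst_pair (hu : MvPowerSeries.constantCoeff u = 0)
    (hv : MvPowerSeries.constantCoeff v = 0) : MvPowerSeries.HasSubst ![u, v] :=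
  MvPowerSeries.hasSubst_of_constantCoeff_zero (by
    intro s
    fin_cases s
    exacts [hu, hv])

theorem IsConvergentSeries.subst_pair {f : MvPowerSeries (Fin 2) ℂ} (hf : IsConvergentSeries f)
    (hu : IsConvergentSeries u) (hv : IsConvergentSeries v)
    (hu0 : MvPowerSeries.constantCoeff u = 0) (hv0 : MvPowerSeries.constantCoeff v = 0) :
    IsConvergentSeries (MvPowerSeries.subst ![u, v] f) := by
  refine hf.subst ?_ ?_
  · intro s
    fin_cases s
    exacts [hu, hv]
  · intro s
    fin_cases s
    exacts [hu0, hv0]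

theorem subst_subst_pair (h : MvPowerSeries.HasSubst ![u, v]) {b : τ → MvPowerSeries υ ℂ}
    (hb : MvPowerSeries.HasSubst b) (f : MvPowerSeries (Fin 2) ℂ) :
    MvPowerSeries.subst b (MvPowerSeries.subst ![u, v] f) =
      MvPowerSeries.subst ![MvPowerSeries.subst b u, MvPowerSeries.subst b v] f := by
  rw [MvPowerSeries.subst_comp_subst_apply h hb]
  congr 1
  funext s
  fin_cases s <;> rfl

theorem subst_pair_varX (h : MvPowerSeries.HasSubst ![u, v]) :
    MvPowerSeries.subst ![u, v] varX = u := MvPowerSeries.subst_X h 0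

theorem subst_pair_varY (h : MvPowerSeries.HasSubst ![u, v]) :
    MvPowerSeries.subst ![u, v] varY = v := MvPowerSeries.subst_X h 1

theorem subst_pair_inX (h : MvPowerSeries.HasSubst ![u, v]) (φ : PowerSeries ℂ) :
    MvPowerSeries.subst ![u, v] (inX φ) = PowerSeries.subst u φ := by
  unfold inX PowerSeries.subst
  rw [MvPowerSeries.subst_comp_subst_apply (MvPowerSeries.hasSubst_of_constantCoeff_zero
    (fun _ => MvPowerSeries.constantCoeff_X 0)) h]
  simp only [subst_pair_varX h]

theorem subst_pair_self (f : MvPowerSeries (Fin 2) ℂ) :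
    MvPowerSeries.subst ![varX, varY] f = f := by
  have : (![varX, varY] : Fin 2 → MvPowerSeries (Fin 2) ℂ) = MvPowerSeries.X := by
    funext s
    fin_cases s <;> rfl
  rw [this, MvPowerSeries.subst_self, id]

theorem constantCoeff_subst_of_zero {σ : Type*} [Finite σ] {a : σ → MvPowerSeries τ ℂ}
    (h0 : ∀ s, MvPowerSeries.constantCoeff (a s) = 0) (f : MvPowerSeries σ ℂ) :
    MvPowerSeries.constantCoeff (MvPowerSeries.subst a f) = MvPowerSeries.constantCoeff f := by
  have h := MvPowerSeries.hasSubst_of_constantCoeff_zero h0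
  have h1 := MvPowerSeries.constantCoeff_subst_eq_zero h h0
    (f := f - MvPowerSeries.C (MvPowerSeries.constantCoeff f)) (by simp)
  rw [MvPowerSeries.subst_sub h, MvPowerSeries.subst_C, map_sub, sub_eq_zero] at h1
  simpa using h1

theorem constantCoeff_subst_pair (hu : MvPowerSeries.constantCoeff u = 0)
    (hv : MvPowerSeries.constantCoeff v = 0) (f : MvPowerSeries (Fin 2) ℂ) :
    MvPowerSeries.constantCoeff (MvPowerSeries.subst ![u, v] f) =
      MvPowerSeries.constantCoeff f := by
  refine constantCoeff_subst_of_zero ?_ f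
  intro s
  fin_cases s
  exacts [hu, hv]

theorem constantCoeff_psubst (hu : MvPowerSeries.constantCoeff u = 0) (φ : PowerSeries ℂ) :
    MvPowerSeries.constantCoeff (PowerSeries.subst u φ) = PowerSeries.constantCoeff φ :=
  constantCoeff_subst_of_zero (fun _ => hu) φ

theorem IsConvergentSeries.psubst {φ : PowerSeries ℂ} (hφ : IsConvergentSeries φ)
    (hu : IsConvergentSeries u) (hu0 : MvPowerSeries.constantCoeff u = 0) :
    IsConvergentSeries (PowerSeries.subst u φ) :=
  IsConvergentSeries.subst hφ (fun _ => hu) (fun _ => hu0)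

theorem constantCoeff_inX (φ : PowerSeries ℂ) :
    MvPowerSeries.constantCoeff (inX φ) = PowerSeries.constantCoeff φ :=
  constantCoeff_psubst (MvPowerSeries.constantCoeff_X 0) φ

theorem isConvergentSeries_inX {φ : PowerSeries ℂ} (hφ : IsConvergentSeries φ) :
    IsConvergentSeries (inX φ) :=
  hφ.psubst (IsConvergentSeries.X 0) (MvPowerSeries.constantCoeff_X 0)

theorem constantCoeff_aeval (hu : MvPowerSeries.constantCoeff u = 0) (q : Polynomial ℂ) :
    MvPowerSeries.constantCoeff (Polynomial.aeval u q) = q.eval 0 := by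
  have h : ∀ w : MvPowerSeries τ ℂ, MvPowerSeries.constantCoeff (R := ℂ) w = 0 →
      MvPowerSeries.constantCoeff (Polynomial.aeval w q) = q.eval 0 := by
    intro w hw
    rw [Polynomial.aeval_def, Polynomial.hom_eval₂, hw]
    have : (MvPowerSeries.constantCoeff.comp (algebraMap ℂ (MvPowerSeries τ ℂ))) =
        RingHom.id ℂ := by
      ext c
      simp [MvPowerSeries.algebraMap_apply]
    rw [this, Polynomial.eval₂_id]
  exact h u hu

theorem inX_coe (q : Polynomial ℂ) : inX (q : PowerSeries ℂ) = polyInX q :=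
  PowerSeries.subst_coe (PowerSeries.HasSubst.X 0) q

theorem coeff_inX (φ : PowerSeries ℂ) (d : Fin 2 →₀ ℕ) :
    MvPowerSeries.coeff d (inX φ) = if d 1 = 0 then PowerSeries.coeff (d 0) φ else 0 := by
  unfold inX
  rw [PowerSeries.coeff_subst_single]
  refine if_congr ?_ rfl rfl
  constructor
  · intro h
    rw [h]
    simp
  · intro h
    ext s
    fin_cases s <;> simp [h]

theorem psubst_X_zero_coeff (f : MvPowerSeries (Fin 2) ℂ) (k : ℕ) :
    PowerSeries.coeff k (MvPowerSeries.subst ![(PowerSeries.X : PowerSeries ℂ), 0] f) =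
      MvPowerSeries.coeff (Finsupp.single 0 k) f := by
  have h : MvPowerSeries.HasSubst ![(PowerSeries.X : PowerSeries ℂ), 0] :=
    hasSubst_pair (MvPowerSeries.constantCoeff_X ()) (map_zero _)
  unfold PowerSeries.coeff
  rw [MvPowerSeries.coeff_subst h, finsum_eq_single _ (Finsupp.single 0 k)]
  · rw [Finsupp.prod_single_index (by exact pow_zero _)]
    change _ • PowerSeries.coeff k (PowerSeries.X ^ k) = _
    simp
  · intro d hd
    rw [Finsupp.prod_fintype _ _ (fun _ => pow_zero _), Fin.prod_univ_two]
    change _ • PowerSeries.coeff k ((PowerSeries.X : PowerSeries ℂ) ^ d 0 * 0 ^ d 1) = _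
    by_cases h1 : d 1 = 0
    · have h0 : k ≠ d 0 := by
        rintro rfl
        apply hd
        ext s
        fin_cases s <;> simp [h1]
      rw [h1, pow_zero, mul_one, PowerSeries.coeff_X_pow, if_neg h0, smul_zero]
    · rw [zero_pow h1, mul_zero, map_zero, smul_zero]

theorem psubst_zero_X_coeff (f : MvPowerSeries (Fin 2) ℂ) (k : ℕ) :
    PowerSeries.coeff k (MvPowerSeries.subst ![0, (PowerSeries.X : PowerSeries ℂ)] f) =
      MvPowerSeries.coeff (Finsupp.single 1 k) f := by
  have h : MvPowerSeries.HasSubst ![0, (PowerSeries.X : PowerSeries ℂ)] :=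
    hasSubst_pair (map_zero _) (MvPowerSeries.constantCoeff_X ())
  unfold PowerSeries.coeff
  rw [MvPowerSeries.coeff_subst h, finsum_eq_single _ (Finsupp.single 1 k)]
  · rw [Finsupp.prod_single_index (by exact pow_zero _)]
    change _ • PowerSeries.coeff k (PowerSeries.X ^ k) = _
    simp
  · intro d hd
    rw [Finsupp.prod_fintype _ _ (fun _ => pow_zero _), Fin.prod_univ_two]
    change _ • PowerSeries.coeff k (0 ^ d 0 * (PowerSeries.X : PowerSeries ℂ) ^ d 1) = _
    by_cases h1 : d 0 = 0
    · have h0 : k ≠ d 1 := by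
        rintro rfl
        apply hd
        ext s
        fin_cases s <;> simp [h1]
      rw [h1, pow_zero, one_mul, PowerSeries.coeff_X_pow, if_neg h0, smul_zero]
    · rw [zero_pow h1, zero_mul, map_zero, smul_zero]

theorem varY_dvd_of_psubst_eq_zero {f : MvPowerSeries (Fin 2) ℂ}
    (h : MvPowerSeries.subst ![(PowerSeries.X : PowerSeries ℂ), 0] f = (0 : PowerSeries ℂ)) :
    varY ∣ f := by
  rw [MvPowerSeries.X_dvd_iff]
  intro d hd
  have h1 := psubst_X_zero_coeff f (d 0)
  rw [h, map_zero] at h1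
  have h2 : d = Finsupp.single 0 (d 0) := by
    ext s
    fin_cases s <;> simp [hd]
  rw [h2]
  exact h1.symm

/-- If every monomial of `f` becomes divisible by `x_s^M` under a substitution, then so does `f`. -/
theorem X_pow_dvd_subst {σ : Type*} {a : σ → MvPowerSeries τ ℂ} (ha : MvPowerSeries.HasSubst a)
    {f : MvPowerSeries σ ℂ} {s : τ} {M : ℕ}
    (h : ∀ d, MvPowerSeries.coeff d f ≠ 0 → MvPowerSeries.X s ^ M ∣ d.prod fun t e => a t ^ e) :
    MvPowerSeries.X s ^ M ∣ MvPowerSeries.subst a f := by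
  rw [MvPowerSeries.X_pow_dvd_iff]
  intro e he
  rw [MvPowerSeries.coeff_subst ha]
  refine finsum_eq_zero_of_forall_eq_zero fun d => ?_
  by_cases hd : MvPowerSeries.coeff d f = 0
  · rw [hd, zero_smul]
  · rw [MvPowerSeries.X_pow_dvd_iff.1 (h d hd) e he, smul_zero]

theorem X_pow_dvd_subst_pair {f : MvPowerSeries (Fin 2) ℂ} {s : τ} {b c M : ℕ}
    (hu : MvPowerSeries.constantCoeff u = 0) (hv : MvPowerSeries.constantCoeff v = 0)
    (hub : MvPowerSeries.X s ^ b ∣ u) (hvc : MvPowerSeries.X s ^ c ∣ v)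
    (h : ∀ d, MvPowerSeries.coeff d f ≠ 0 → M ≤ b * d 0 + c * d 1) :
    MvPowerSeries.X s ^ M ∣ MvPowerSeries.subst ![u, v] f := by
  refine X_pow_dvd_subst (hasSubst_pair hu hv) fun d hd => ?_
  rw [Finsupp.prod_fintype _ _ (fun _ => pow_zero _), Fin.prod_univ_two]
  refine (pow_dvd_pow _ (h d hd)).trans ?_
  rw [pow_add, pow_mul, pow_mul]
  exact mul_dvd_mul (pow_dvd_pow_of_dvd hub _) (pow_dvd_pow_of_dvd hvc _)

end pair

/-! ### Shears, the factor theorem and Hadamard's lemma -/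

section shift

variable {τ : Type*} {u v : MvPowerSeries τ ℂ} {φ : PowerSeries ℂ}

theorem constantCoeff_varY_add_inX (hφ : PowerSeries.constantCoeff φ = 0) :
    MvPowerSeries.constantCoeff (varY + inX φ) = 0 := by
  rw [map_add, constantCoeff_inX, hφ, MvPowerSeries.constantCoeff_X, add_zero]

theorem subst_subst_shift (hφ : PowerSeries.constantCoeff φ = 0)
    (hu : MvPowerSeries.constantCoeff u = 0) (hv : MvPowerSeries.constantCoeff v = 0)
    (f : MvPowerSeries (Fin 2) ℂ) :
    MvPowerSeries.subst ![u, v] (MvPowerSeries.subst ![varX, varY + inX φ] f) =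
      MvPowerSeries.subst ![u, v + PowerSeries.subst u φ] f := by
  have h := hasSubst_pair hu hv
  rw [subst_subst_pair (hasSubst_pair (MvPowerSeries.constantCoeff_X 0)
    (constantCoeff_varY_add_inX hφ)) h, subst_pair_varX h, MvPowerSeries.subst_add h,
    subst_pair_varY h, subst_pair_inX h]

theorem psubst_neg (hu : MvPowerSeries.constantCoeff u = 0) (φ : PowerSeries ℂ) :
    PowerSeries.subst u (-φ) = -PowerSeries.subst u φ := by
  have h := PowerSeries.HasSubst.of_constantCoeff_zero hu
  rw [← PowerSeries.coe_substAlgHom h, map_neg]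

theorem inX_neg (φ : PowerSeries ℂ) : inX (-φ) = -inX φ :=
  psubst_neg (MvPowerSeries.constantCoeff_X 0) φ

theorem subst_shift_neg (hφ : PowerSeries.constantCoeff φ = 0) (f : MvPowerSeries (Fin 2) ℂ) :
    MvPowerSeries.subst ![varX, varY + inX (-φ)]
      (MvPowerSeries.subst ![varX, varY + inX φ] f) = f := by
  rw [subst_subst_shift hφ (MvPowerSeries.constantCoeff_X 0)
    (constantCoeff_varY_add_inX (by rw [map_neg, hφ, neg_zero])), inX_neg]
  change MvPowerSeries.subst ![varX, varY + -inX φ + inX φ] f = f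
  rw [neg_add_cancel_right, subst_pair_self]

theorem IsConvergentSeries.subst_shift {f : MvPowerSeries (Fin 2) ℂ} (hf : IsConvergentSeries f)
    (hφc : IsConvergentSeries φ) (hφ : PowerSeries.constantCoeff φ = 0) :
    IsConvergentSeries (MvPowerSeries.subst ![varX, varY + inX φ] f) :=
  hf.subst_pair (IsConvergentSeries.X 0) ((IsConvergentSeries.X 1).add (isConvergentSeries_inX hφc))
    (MvPowerSeries.constantCoeff_X 0) (constantCoeff_varY_add_inX hφ)

theorem psubst_X_subst_shift {g : PowerSeries ℂ} (hφ : PowerSeries.constantCoeff φ = 0)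
    (hg : PowerSeries.constantCoeff g = 0) (f : MvPowerSeries (Fin 2) ℂ) :
    MvPowerSeries.subst ![(PowerSeries.X : PowerSeries ℂ), g]
      (MvPowerSeries.subst ![varX, varY + inX φ] f) =
        MvPowerSeries.subst ![(PowerSeries.X : PowerSeries ℂ), g + φ] f := by
  rw [subst_subst_shift hφ (u := (PowerSeries.X : PowerSeries ℂ))
    (MvPowerSeries.constantCoeff_X ()) hg]
  congr 3
  exact congrArg (g + ·) (PowerSeries.X_subst φ)

theorem coeff_single_one_subst_shift (hφ : PowerSeries.constantCoeff φ = 0)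
    (f : MvPowerSeries (Fin 2) ℂ) (k : ℕ) :
    MvPowerSeries.coeff (Finsupp.single 1 k) (MvPowerSeries.subst ![varX, varY + inX φ] f) =
      MvPowerSeries.coeff (Finsupp.single 1 k) f := by
  rw [← psubst_zero_X_coeff, ← psubst_zero_X_coeff,
    subst_subst_shift hφ (v := (PowerSeries.X : PowerSeries ℂ)) (map_zero _)
      (MvPowerSeries.constantCoeff_X ())]
  congr 4
  have h0 : PowerSeries.subst (0 : PowerSeries ℂ) φ = (0 : PowerSeries ℂ) :=
    PowerSeries.subst_zero_of_constantCoeff_zero hφ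
  exact (congrArg (PowerSeries.X + ·) h0).trans (add_zero _)

/-- The factor theorem: a shear moves the root `-φ` to `y = 0`, where divisibility by `y` is visible
on coefficients, and the inverse shear brings the quotient back. Shears and division by `y` preserve
convergence. -/
theorem exists_eq_mul_of_psubst_eq_zero {f : MvPowerSeries (Fin 2) ℂ}
    (hφ : PowerSeries.constantCoeff φ = 0)
    (h : MvPowerSeries.subst ![(PowerSeries.X : PowerSeries ℂ), -φ] f = (0 : PowerSeries ℂ)) :
    ∃ q, f = (varY + inX φ) * q ∧
      (IsConvergentSeries f → IsConvergentSeries φ → IsConvergentSeries q) := by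
  have hφ' : PowerSeries.constantCoeff (-φ) = 0 := by rw [map_neg, hφ, neg_zero]
  obtain ⟨q, hq⟩ : varY ∣ MvPowerSeries.subst ![varX, varY + inX (-φ)] f := by
    apply varY_dvd_of_psubst_eq_zero
    rw [psubst_X_subst_shift hφ' (map_zero _), zero_add, h]
  have hs := hasSubst_pair (MvPowerSeries.constantCoeff_X 0) (constantCoeff_varY_add_inX hφ)
  refine ⟨MvPowerSeries.subst ![varX, varY + inX φ] q, ?_, fun hf hc => ?_⟩
  · have h1 := subst_shift_neg hφ' f
    rw [neg_neg, hq, MvPowerSeries.subst_mul hs, subst_pair_varY hs] at h1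
    exact h1.symm
  · have h2 : IsConvergentSeries (varY ^ 1 * q) := by
      rw [pow_one, ← hq]
      exact hf.subst_shift hc.neg hφ'
    exact h2.of_X_pow_mul.subst_shift hc hφ

/-- Hadamard's lemma: `f(x, g) - f(x, g') = (g - g') u`, with `u(0) = ∂f/∂y(0, 0)`. -/
theorem exists_psubst_sub_eq_mul {g g' : PowerSeries ℂ} (hg : PowerSeries.constantCoeff g = 0)
    (hg' : PowerSeries.constantCoeff g' = 0) (f : MvPowerSeries (Fin 2) ℂ) :
    ∃ w : PowerSeries ℂ,
      PowerSeries.constantCoeff w = MvPowerSeries.coeff (Finsupp.single 1 1) f ∧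
      MvPowerSeries.subst ![(PowerSeries.X : PowerSeries ℂ), g] f -
        MvPowerSeries.subst ![(PowerSeries.X : PowerSeries ℂ), g'] f = (g - g') * w := by
  set T := MvPowerSeries.subst ![varX, varY + inX g'] f with hT
  set A : PowerSeries ℂ := MvPowerSeries.subst ![(PowerSeries.X : PowerSeries ℂ), g'] f with hA
  have h0 : ∀ k : PowerSeries ℂ, PowerSeries.constantCoeff k = 0 →
      MvPowerSeries.HasSubst ![(PowerSeries.X : PowerSeries ℂ), k] := fun k hk =>
    hasSubst_pair (MvPowerSeries.constantCoeff_X ()) hk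
  have hin : ∀ k : PowerSeries ℂ, PowerSeries.constantCoeff k = 0 →
      MvPowerSeries.subst ![(PowerSeries.X : PowerSeries ℂ), k] (inX A) = A := fun k hk => by
    rw [subst_pair_inX (h0 k hk)]
    exact PowerSeries.X_subst A
  -- The shear moves the curve `y = g'` to `y = 0`, on which `T` restricts to `A = f(x, g')`.
  obtain ⟨q, hq⟩ : varY ∣ T - inX A := by
    apply varY_dvd_of_psubst_eq_zero
    rw [MvPowerSeries.subst_sub (h0 0 (map_zero _)), hin 0 (map_zero _), hT,
      psubst_X_subst_shift hg' (map_zero _), zero_add, ← hA, sub_self]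
  have hgg : PowerSeries.constantCoeff (g - g') = 0 := by rw [map_sub, hg, hg', sub_zero]
  refine ⟨MvPowerSeries.subst ![(PowerSeries.X : PowerSeries ℂ), g - g'] q, ?_, ?_⟩
  · have h1 := constantCoeff_subst_pair (u := (PowerSeries.X : PowerSeries ℂ))
      (v := g - g') (MvPowerSeries.constantCoeff_X ()) hgg q
    refine h1.trans ?_
    have h2 : MvPowerSeries.coeff (Finsupp.single 1 1) (T - inX A) =
        MvPowerSeries.constantCoeff q := by
      have h3 := MvPowerSeries.coeff_add_monomial_mul (Finsupp.single 1 1) 0 q 1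
      rw [add_zero, one_mul, MvPowerSeries.coeff_zero_eq_constantCoeff] at h3
      rw [hq]
      exact h3
    rw [← h2, map_sub, coeff_inX, hT, coeff_single_one_subst_shift hg']
    simp
  · have h1 := congrArg (MvPowerSeries.subst ![(PowerSeries.X : PowerSeries ℂ), g - g']) hq
    rw [MvPowerSeries.subst_sub (h0 _ hgg), hin _ hgg, MvPowerSeries.subst_mul (h0 _ hgg),
      subst_pair_varY (h0 _ hgg), hT, psubst_X_subst_shift hg' hgg, sub_add_cancel] at h1
    exact h1

end shift

/-! ### The implicit function theorem -/

section implicitFunction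

theorem implicit_unique {F : MvPowerSeries (Fin 2) ℂ} {g g' : PowerSeries ℂ}
    (h1 : MvPowerSeries.coeff (Finsupp.single 1 1) F ≠ 0)
    (hg : PowerSeries.constantCoeff g = 0) (hg' : PowerSeries.constantCoeff g' = 0)
    (h : MvPowerSeries.subst ![(PowerSeries.X : PowerSeries ℂ), g] F = (0 : PowerSeries ℂ))
    (h' : MvPowerSeries.subst ![(PowerSeries.X : PowerSeries ℂ), g'] F = (0 : PowerSeries ℂ)) :
    g = g' := by
  obtain ⟨w, hw, e⟩ := exists_psubst_sub_eq_mul hg hg' F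
  rw [h, h', sub_zero, eq_comm, mul_eq_zero] at e
  rcases e with e | e
  · exact sub_eq_zero.1 e
  · rw [e, map_zero] at hw
    exact absurd hw.symm h1

/-- The iterates `g ↦ G(x, g)` starting from `0`. -/
noncomputable def fixIter (G : MvPowerSeries (Fin 2) ℂ) : ℕ → PowerSeries ℂ
  | 0 => 0
  | k + 1 => MvPowerSeries.subst ![(PowerSeries.X : PowerSeries ℂ), fixIter G k] G

variable {G : MvPowerSeries (Fin 2) ℂ}

theorem constantCoeff_fixIter (h0 : MvPowerSeries.constantCoeff G = 0) (k : ℕ) :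
    PowerSeries.constantCoeff (fixIter G k) = 0 := by
  induction k with
  | zero => exact map_zero _
  | succ k ih =>
    exact (constantCoeff_subst_pair (u := (PowerSeries.X : PowerSeries ℂ))
      (MvPowerSeries.constantCoeff_X ()) ih G).trans h0

/-- Contraction in the `X`-adic sense: the Hadamard cofactor has constant term `∂G/∂y(0, 0) = 0`, so
it contributes one more power of `X`. -/
theorem X_pow_succ_dvd_psubst_sub (h1 : MvPowerSeries.coeff (Finsupp.single 1 1) G = 0)
    {g g' : PowerSeries ℂ}
    (hg : PowerSeries.constantCoeff g = 0) (hg' : PowerSeries.constantCoeff g' = 0) {k : ℕ}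
    (h : PowerSeries.X ^ k ∣ g - g') :
    PowerSeries.X ^ (k + 1) ∣ MvPowerSeries.subst ![(PowerSeries.X : PowerSeries ℂ), g] G -
        MvPowerSeries.subst ![(PowerSeries.X : PowerSeries ℂ), g'] G := by
  obtain ⟨w, hw, e⟩ := exists_psubst_sub_eq_mul hg hg' G
  rw [e, pow_succ]
  exact mul_dvd_mul h (PowerSeries.X_dvd_iff.2 (hw.trans h1))

theorem X_pow_dvd_fixIter_succ_sub (h0 : MvPowerSeries.constantCoeff G = 0)
    (h1 : MvPowerSeries.coeff (Finsupp.single 1 1) G = 0) (k : ℕ) :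
    PowerSeries.X ^ k ∣ fixIter G (k + 1) - fixIter G k := by
  induction k with
  | zero => simp
  | succ k ih =>
    exact X_pow_succ_dvd_psubst_sub h1 (constantCoeff_fixIter h0 _) (constantCoeff_fixIter h0 _) ih

theorem coeff_fixIter_eq (h0 : MvPowerSeries.constantCoeff G = 0)
    (h1 : MvPowerSeries.coeff (Finsupp.single 1 1) G = 0) {n k : ℕ} (h : n + 1 ≤ k) :
    PowerSeries.coeff n (fixIter G k) = PowerSeries.coeff n (fixIter G (n + 1)) := by
  induction k, h using Nat.le_induction with
  | base => rfl
  | succ k hk ih =>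
    rw [← ih, ← sub_eq_zero, ← map_sub]
    exact PowerSeries.X_pow_dvd_iff.1 (X_pow_dvd_fixIter_succ_sub h0 h1 k) n hk

theorem wnorm_fixIter_le (h0 : MvPowerSeries.constantCoeff G = 0) {ρ R : ℝ≥0}
    (hR : ∑' d : Fin 2 →₀ ℕ, ‖MvPowerSeries.coeff d G‖ₑ * ((ρ : ℝ≥0∞) ^ d 0 * (R : ℝ≥0∞) ^ d 1)
      ≤ R) (k : ℕ) : wnorm ρ (fixIter G k) ≤ R := by
  induction k with
  | zero =>
    have : wnorm ρ (0 : PowerSeries ℂ) = 0 := by simp [wnorm]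
    exact this.trans_le zero_le
  | succ k ih =>
    refine (wnorm_subst_le (hasSubst_pair (MvPowerSeries.constantCoeff_X ())
      (constantCoeff_fixIter h0 k)) ρ G).trans (le_trans ?_ hR)
    refine ENNReal.tsum_le_tsum fun d => ?_
    rw [Finsupp.prod_fintype _ _ (fun _ => pow_zero _), Fin.prod_univ_two]
    gcongr
    · exact (wnorm_X ρ ()).le
    · exact ih

/-- Give `x` weight 2 and `y` weight 1. Without constant and `y`-linear terms every monomial of `G`
has weight at least 2. Scaling `x` by `ε²` and `y` by `ε` therefore gains `ε²`, of which one `ε`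
beats the norm of `G` and the other is left for `R = εr`. -/
theorem exists_radii (hG : IsConvergentSeries G) (h0 : MvPowerSeries.constantCoeff G = 0)
    (h1 : MvPowerSeries.coeff (Finsupp.single 1 1) G = 0) :
    ∃ ρ R : ℝ≥0, 0 < ρ ∧
      ∑' d : Fin 2 →₀ ℕ, ‖MvPowerSeries.coeff d G‖ₑ * ((ρ : ℝ≥0∞) ^ d 0 * (R : ℝ≥0∞) ^ d 1)
        ≤ R := by
  obtain ⟨r, hr, h⟩ := isConvergentSeries_iff_wnorm.1 hG
  obtain ⟨ε, hε, hε1, hεK⟩ := exists_pos_mul_le _ h hr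
  refine ⟨ε ^ 2 * r, ε * r, by positivity, ?_⟩
  calc _ ≤ ∑' d : Fin 2 →₀ ℕ,
        (ε : ℝ≥0∞) ^ 2 * (‖MvPowerSeries.coeff d G‖ₑ * (r : ℝ≥0∞) ^ d.degree) := by
        refine ENNReal.tsum_le_tsum fun d => ?_
        by_cases hd : MvPowerSeries.coeff d G = 0
        · simp [hd]
        have h2 : 2 ≤ 2 * d 0 + d 1 := by
          by_contra hlt
          have ha : d 0 = 0 := by omega
          have hb : d 1 = 0 ∨ d 1 = 1 := by omega
          rcases hb with hb | hb
          · have : d = 0 := by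
              ext s
              fin_cases s <;> simp [ha, hb]
            rw [this] at hd
            exact hd h0
          · have : d = Finsupp.single 1 1 := by
              ext s
              fin_cases s <;> simp [ha, hb]
            rw [this] at hd
            exact hd h1
        have h3 : (ε : ℝ≥0∞) ^ (2 * d 0 + d 1) ≤ (ε : ℝ≥0∞) ^ 2 :=
          pow_le_pow_of_le_one zero_le (by exact_mod_cast hε1) h2
        have h4 : d.degree = d 0 + d 1 := by
          rw [Finsupp.degree_eq_sum, Fin.sum_univ_two]
        rw [h4]
        calc _ = (ε : ℝ≥0∞) ^ (2 * d 0 + d 1) *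
              (‖MvPowerSeries.coeff d G‖ₑ * (r : ℝ≥0∞) ^ (d 0 + d 1)) := by
              push_cast
              ring
          _ ≤ _ := by gcongr
    _ = (ε : ℝ≥0∞) * (ε * wnorm r G) := by
        rw [ENNReal.tsum_mul_left, ← mul_assoc, ← pow_two]
        rfl
    _ ≤ _ := by
        push_cast
        gcongr

theorem exists_fixedPoint (hG : IsConvergentSeries G) (h0 : MvPowerSeries.constantCoeff G = 0)
    (h1 : MvPowerSeries.coeff (Finsupp.single 1 1) G = 0) :
    ∃ g : PowerSeries ℂ, IsConvergentSeries g ∧ PowerSeries.constantCoeff g = 0 ∧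
      MvPowerSeries.subst ![(PowerSeries.X : PowerSeries ℂ), g] G = g := by
  set g : PowerSeries ℂ := PowerSeries.mk fun n => PowerSeries.coeff n (fixIter G (n + 1)) with hg
  have hgk : ∀ n k, n + 1 ≤ k → PowerSeries.coeff n g = PowerSeries.coeff n (fixIter G k) := by
    intro n k hk
    rw [hg, PowerSeries.coeff_mk, coeff_fixIter_eq h0 h1 hk]
  have hgz : PowerSeries.constantCoeff g = 0 := by
    rw [← PowerSeries.coeff_zero_eq_constantCoeff_apply, hgk 0 1 le_rfl,
      PowerSeries.coeff_zero_eq_constantCoeff_apply, constantCoeff_fixIter h0]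
  refine ⟨g, ?_, hgz, ?_⟩
  · obtain ⟨ρ, R, hρ, hR⟩ := exists_radii hG h0 h1
    refine isConvergentSeries_iff_wnorm.2 ⟨ρ, hρ, ne_top_of_le_ne_top (b := (R : ℝ≥0∞))
      ENNReal.coe_ne_top ?_⟩
    unfold wnorm
    rw [ENNReal.tsum_eq_iSup_sum]
    refine iSup_le fun s => ?_
    refine le_trans ?_ (wnorm_fixIter_le h0 hR (s.sup (fun d => d ()) + 1))
    -- On a finite set of exponents the limit agrees with a sufficiently late iterate, so its
    -- partial sums inherit the uniform bound `R`.
    refine le_trans (Finset.sum_le_sum fun d hd => ?_) (ENNReal.sum_le_tsum s)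
    have hds : d = Finsupp.single () (d ()) := by
      ext
      simp
    have h2 := hgk (d ()) (s.sup (fun d => d ()) + 1)
      (Nat.succ_le_succ (Finset.le_sup (f := fun d : Unit →₀ ℕ => d ()) hd))
    unfold PowerSeries.coeff at h2
    rw [← hds] at h2
    rw [h2]
  · have key : ∀ k, PowerSeries.X ^ k ∣
        MvPowerSeries.subst ![(PowerSeries.X : PowerSeries ℂ), g] G - g := by
      intro k
      have ha : ∀ k, PowerSeries.X ^ k ∣ g - fixIter G k := fun k =>
        PowerSeries.X_pow_dvd_iff.2 fun n hn => by rw [map_sub, hgk n k hn, sub_self]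
      have hb := X_pow_succ_dvd_psubst_sub h1 hgz (constantCoeff_fixIter h0 k) (ha k)
      -- The iterate cancels: `G(x, g)` and `g` are both congruent to it modulo `X^(k+1)`.
      have hc := dvd_sub hb (ha (k + 1))
      refine (pow_dvd_pow _ k.le_succ).trans (hc.trans (dvd_of_eq ?_))
      change _ - fixIter G (k + 1) - _ = _
      ring
    rw [← sub_eq_zero]
    ext n
    exact PowerSeries.X_pow_dvd_iff.1 (key (n + 1)) n n.lt_succ_self

/-- The implicit function theorem for convergent power series. -/
theorem exists_implicit {F : MvPowerSeries (Fin 2) ℂ} (hF : IsConvergentSeries F)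
    (h0 : MvPowerSeries.constantCoeff F = 0)
    (h1 : MvPowerSeries.coeff (Finsupp.single 1 1) F ≠ 0) :
    ∃ g : PowerSeries ℂ, IsConvergentSeries g ∧ PowerSeries.constantCoeff g = 0 ∧
      MvPowerSeries.subst ![(PowerSeries.X : PowerSeries ℂ), g] F = (0 : PowerSeries ℂ) := by
  set c := MvPowerSeries.coeff (Finsupp.single 1 1) F
  -- Fixed points of `y - c⁻¹F` are the zeros of `F`, and the division by `c` removes the `y`-linear
  -- coefficient.
  obtain ⟨g, hg, hg0, e⟩ := exists_fixedPoint (G := varY - c⁻¹ • F)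
    ((IsConvergentSeries.X 1).sub (hF.smul _)) (by simp [h0])
    (by
      rw [map_sub, MvPowerSeries.coeff_index_single_self_X, MvPowerSeries.coeff_smul]
      exact sub_eq_zero.2 (inv_mul_cancel₀ h1).symm)
  refine ⟨g, hg, hg0, ?_⟩
  have hs : MvPowerSeries.HasSubst ![(PowerSeries.X : PowerSeries ℂ), g] :=
    hasSubst_pair (MvPowerSeries.constantCoeff_X ()) hg0
  rw [MvPowerSeries.subst_sub hs, subst_pair_varY hs, MvPowerSeries.subst_smul hs,
    sub_eq_self] at e
  exact (smul_eq_zero.1 e).resolve_left (inv_ne_zero h1)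

end implicitFunction

/-! ### Iterated derivatives in `y` -/

section iteratedDerivative

theorem coeff_iterate_pderiv (f : MvPowerSeries (Fin 2) ℂ) (n : ℕ) (d : Fin 2 →₀ ℕ) :
    MvPowerSeries.coeff d
      ((fun f : MvPowerSeries (Fin 2) ℂ => MvPowerSeries.pderiv ℂ 1 f)^[n] f) =
      ((d 1 + 1).ascFactorial n : ℂ) * MvPowerSeries.coeff (d + Finsupp.single 1 n) f := by
  induction n generalizing f with
  | zero => simp
  | succ n ih =>
    rw [Function.iterate_succ_apply, ih, MvPowerSeries.coeff_pderiv, Nat.ascFactorial_succ,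
      add_assoc, ← Finsupp.single_add]
    push_cast
    simp
    ring

/-- The shear is a translation in `y` by a series in `x` alone, so the chain rule contributes only
the factor `1`. -/
theorem pderiv_subst_shift {φ : PowerSeries ℂ} (hφ : PowerSeries.constantCoeff φ = 0)
    (f : MvPowerSeries (Fin 2) ℂ) :
    MvPowerSeries.pderiv ℂ 1 (MvPowerSeries.subst ![varX, varY + inX φ] f) =
      MvPowerSeries.subst ![varX, varY + inX φ] (MvPowerSeries.pderiv ℂ 1 f) := by
  have h0 : MvPowerSeries.pderiv ℂ (1 : Fin 2) (inX φ) = 0 := by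
    ext d
    rw [MvPowerSeries.coeff_pderiv, coeff_inX, if_neg (by simp), zero_mul, map_zero]
  rw [pderiv_subst (hasSubst_pair (MvPowerSeries.constantCoeff_X 0)
    (constantCoeff_varY_add_inX hφ)), Fin.sum_univ_two]
  change _ * MvPowerSeries.pderiv ℂ 1 varX + _ * MvPowerSeries.pderiv ℂ 1 (varY + inX φ) = _
  rw [MvPowerSeries.pderiv_X_of_ne (by decide), mul_zero, zero_add, map_add, h0,
    MvPowerSeries.pderiv_X_self, add_zero, mul_one]

theorem iterate_pderiv_subst_shift {φ : PowerSeries ℂ} (hφ : PowerSeries.constantCoeff φ = 0)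
    (f : MvPowerSeries (Fin 2) ℂ) (n : ℕ) :
    (fun f : MvPowerSeries (Fin 2) ℂ => MvPowerSeries.pderiv ℂ 1 f)^[n]
        (MvPowerSeries.subst ![varX, varY + inX φ] f) =
      MvPowerSeries.subst ![varX, varY + inX φ]
        ((fun f : MvPowerSeries (Fin 2) ℂ => MvPowerSeries.pderiv ℂ 1 f)^[n] f) := by
  induction n generalizing f with
  | zero => rfl
  | succ n ih =>
    rw [Function.iterate_succ_apply, Function.iterate_succ_apply, ← ih]
    congr 1
    exact pderiv_subst_shift hφ f

theorem IsConvergentSeries.iterate_pderiv {f : MvPowerSeries (Fin 2) ℂ}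
    (hf : IsConvergentSeries f) (n : ℕ) : IsConvergentSeries
      ((fun f : MvPowerSeries (Fin 2) ℂ => MvPowerSeries.pderiv ℂ 1 f)^[n] f) := by
  induction n generalizing f with
  | zero => exact hf
  | succ n ih =>
    rw [Function.iterate_succ_apply]
    exact ih (hf.pderiv 1)

end iteratedDerivative

/-! ### Order in `y` and the Tschirnhausen shift -/

/-- The lowest power of `y` in `f(0, y)` is `y^k`. -/
def HasYOrder (f : MvPowerSeries (Fin 2) ℂ) (k : ℕ) : Prop :=
  MvPowerSeries.coeff (Finsupp.single 1 k) f ≠ 0 ∧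
    ∀ i < k, MvPowerSeries.coeff (Finsupp.single 1 i) f = 0

theorem HasYOrder.subst_shift {f : MvPowerSeries (Fin 2) ℂ} {k : ℕ} (hf : HasYOrder f k)
    {φ : PowerSeries ℂ} (hφ : PowerSeries.constantCoeff φ = 0) :
    HasYOrder (MvPowerSeries.subst ![varX, varY + inX φ] f) k := by
  unfold HasYOrder
  simp only [coeff_single_one_subst_shift hφ]
  exact hf

theorem HasYOrder.constantCoeff_iterate_pderiv {f : MvPowerSeries (Fin 2) ℂ} {k : ℕ}
    (hf : HasYOrder f (k + 1)) : MvPowerSeries.constantCoeff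
      ((fun f : MvPowerSeries (Fin 2) ℂ => MvPowerSeries.pderiv ℂ 1 f)^[k] f) = 0 := by
  rw [← MvPowerSeries.coeff_zero_eq_constantCoeff_apply, coeff_iterate_pderiv, zero_add,
    hf.2 k k.lt_succ_self, mul_zero]

theorem coeff_single_one_one_iterate_pderiv (f : MvPowerSeries (Fin 2) ℂ) (k : ℕ) :
    MvPowerSeries.coeff (Finsupp.single 1 1)
      ((fun f : MvPowerSeries (Fin 2) ℂ => MvPowerSeries.pderiv ℂ 1 f)^[k] f) =
      ((k + 1).factorial : ℂ) * MvPowerSeries.coeff (Finsupp.single 1 (k + 1)) f := by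
  rw [coeff_iterate_pderiv, ← Finsupp.single_add, add_comm 1 k]
  congr 2
  have := Nat.factorial_mul_ascFactorial 1 k
  simpa [add_comm] using this

/-- The formal analogue of the Tschirnhausen transformation. -/
theorem HasYOrder.exists_shift {f : MvPowerSeries (Fin 2) ℂ} {k : ℕ}
    (hf : HasYOrder f (k + 1)) (hc : IsConvergentSeries f) :
    ∃ g : PowerSeries ℂ, IsConvergentSeries g ∧ PowerSeries.constantCoeff g = 0 ∧
      ∀ d : Fin 2 →₀ ℕ, d 1 = k →
        MvPowerSeries.coeff d (MvPowerSeries.subst ![varX, varY + inX g] f) = 0 := by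
  -- Take `g` to be the root of the `k`-th `y`-derivative. After the shear this derivative vanishes
  -- on `y = 0`, where it consists of the coefficients of `y^k` up to nonzero factors.
  obtain ⟨g, hg, hg0, h⟩ := exists_implicit (hc.iterate_pderiv k) hf.constantCoeff_iterate_pderiv
    (by
      rw [coeff_single_one_one_iterate_pderiv]
      exact mul_ne_zero (by exact_mod_cast Nat.factorial_ne_zero _) hf.1)
  refine ⟨g, hg, hg0, fun d hd => ?_⟩
  have h1 := psubst_X_subst_shift hg0 (map_zero _)
    ((fun f : MvPowerSeries (Fin 2) ℂ => MvPowerSeries.pderiv ℂ 1 f)^[k] f)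
  rw [zero_add, h, ← iterate_pderiv_subst_shift hg0] at h1
  have h2 := psubst_X_zero_coeff ((fun f : MvPowerSeries (Fin 2) ℂ =>
    MvPowerSeries.pderiv ℂ 1 f)^[k] (MvPowerSeries.subst ![varX, varY + inX g] f)) (d 0)
  rw [h1, map_zero, coeff_iterate_pderiv, eq_comm, mul_eq_zero] at h2
  have hdd : d = Finsupp.single 0 (d 0) + Finsupp.single 1 k := by
    ext s
    fin_cases s <;> simp [hd]
  rw [hdd]
  refine h2.resolve_left ?_
  exact_mod_cast (Nat.ascFactorial_pos _ _).ne'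

/-! ### Newton polygon and the Newton-Puiseux theorem -/

section edge

/-- The exponents of weight `c k`, where `x` has weight `b` and `y` has weight `c`. -/
noncomputable def edgeSet (b c k : ℕ) : Finset (Fin 2 →₀ ℕ) :=
  (Finset.Iic (Finsupp.single 0 (c * k) + Finsupp.single 1 k)).filter
    fun d => b * d 0 + c * d 1 = c * k

theorem mem_edgeSet {b c k : ℕ} (hb : 0 < b) (hc : 0 < c) {d : Fin 2 →₀ ℕ} :
    d ∈ edgeSet b c k ↔ b * d 0 + c * d 1 = c * k := by
  rw [edgeSet, Finset.mem_filter, and_iff_right_iff_imp, Finset.mem_Iic]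
  intro h s
  fin_cases s
  · have : d 0 ≤ c * k := by nlinarith
    simpa using this
  · have : d 1 ≤ k := Nat.le_of_mul_le_mul_left (by omega : c * d 1 ≤ c * k) hc
    simpa using this

/-- The polynomial attached to the edge of the Newton polygon with the given weights. -/
noncomputable def edgePoly (f : MvPowerSeries (Fin 2) ℂ) (b c k : ℕ) : Polynomial ℂ :=
  ∑ d ∈ edgeSet b c k, Polynomial.monomial (d 1) (MvPowerSeries.coeff d f)

theorem coeff_edgePoly {f : MvPowerSeries (Fin 2) ℂ} {b c k : ℕ} (hb : 0 < b) (hc : 0 < c)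
    {d : Fin 2 →₀ ℕ} (hd : b * d 0 + c * d 1 = c * k) :
    (edgePoly f b c k).coeff (d 1) = MvPowerSeries.coeff d f := by
  rw [edgePoly, Polynomial.finsetSum_coeff, Finset.sum_eq_single d]
  · rw [Polynomial.coeff_monomial, if_pos rfl]
  · intro e he hne
    rw [Polynomial.coeff_monomial, if_neg]
    intro h1
    rw [mem_edgeSet hb hc, h1] at he
    apply hne
    have h0 : e 0 = d 0 := Nat.eq_of_mul_eq_mul_left hb (by omega)
    ext s
    fin_cases s
    exacts [h0, h1]
  · intro h
    exact absurd ((mem_edgeSet hb hc).2 hd) h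

theorem coeff_edgePoly_eq_zero {f : MvPowerSeries (Fin 2) ℂ} {b c k i : ℕ}
    (hi : ∀ d : Fin 2 →₀ ℕ, d 1 = i → MvPowerSeries.coeff d f = 0) :
    (edgePoly f b c k).coeff i = 0 := by
  rw [edgePoly, Polynomial.finsetSum_coeff]
  refine Finset.sum_eq_zero fun d _ => ?_
  rw [Polynomial.coeff_monomial]
  split_ifs with h
  exacts [hi d h, rfl]

theorem natDegree_edgePoly_le {f : MvPowerSeries (Fin 2) ℂ} {b c k : ℕ} (hb : 0 < b) (hc : 0 < c) :
    (edgePoly f b c k).natDegree ≤ k := by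
  refine Polynomial.natDegree_sum_le_of_forall_le _ _ fun d hd => ?_
  refine (Polynomial.natDegree_monomial_le _).trans ?_
  rw [mem_edgeSet hb hc] at hd
  exact Nat.le_of_mul_le_mul_left (by omega : c * d 1 ≤ c * k) hc

theorem constantCoeff_X_pow_mul {τ : Type*} (s : τ) {c : ℕ} (hc : 0 < c)
    (f : MvPowerSeries τ ℂ) : MvPowerSeries.constantCoeff (MvPowerSeries.X s ^ c * f) = 0 := by
  rw [map_mul, map_pow, MvPowerSeries.constantCoeff_X, zero_pow hc.ne', zero_mul]

theorem constantCoeff_X_pow {τ : Type*} (s : τ) {c : ℕ} (hc : 0 < c) :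
    MvPowerSeries.constantCoeff (MvPowerSeries.X s ^ c : MvPowerSeries τ ℂ) = 0 := by
  rw [map_pow, MvPowerSeries.constantCoeff_X, zero_pow hc.ne']

/-- Blowing up along an edge of the Newton polygon. -/
theorem exists_edge_transform {f : MvPowerSeries (Fin 2) ℂ} (hf : IsConvergentSeries f)
    {b c k : ℕ} (hb : 0 < b) (hc : 0 < c)
    (hw : ∀ d, MvPowerSeries.coeff d f ≠ 0 → c * k ≤ b * d 0 + c * d 1) (α : ℂ) :
    ∃ V : MvPowerSeries (Fin 2) ℂ, IsConvergentSeries V ∧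
      MvPowerSeries.subst ![varX ^ b, varX ^ c * (varY + MvPowerSeries.C α)] f =
        varX ^ (c * k) * V ∧
      ∀ i, MvPowerSeries.coeff (Finsupp.single 1 i) V =
        ((edgePoly f b c k).comp (Polynomial.X + Polynomial.C α)).coeff i := by
  classical
  have hu := constantCoeff_X_pow (0 : Fin 2) hb
  have hv := constantCoeff_X_pow_mul (0 : Fin 2) hc (varY + MvPowerSeries.C α)
  have hs := hasSubst_pair hu hv
  set a : Fin 2 → MvPowerSeries (Fin 2) ℂ :=
    ![varX ^ b, varX ^ c * (varY + MvPowerSeries.C α)] with ha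
  -- The part of `f` on the edge. All other terms have weight greater than `c k`, so after the
  -- substitution they carry an extra factor `x` and do not affect `V(0, y)`.
  set top : MvPowerSeries (Fin 2) ℂ :=
    ∑ d ∈ edgeSet b c k, MvPowerSeries.monomial d (MvPowerSeries.coeff d f) with htop
  have hcoeff : ∀ d, MvPowerSeries.coeff d top =
      if d ∈ edgeSet b c k then MvPowerSeries.coeff d f else 0 := by
    intro d
    rw [htop, map_sum]
    simp_rw [MvPowerSeries.coeff_monomial]
    rw [Finset.sum_ite_eq]
  obtain ⟨R, hR⟩ : varX ^ (c * k + 1) ∣ MvPowerSeries.subst a (f - top) := by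
    refine X_pow_dvd_subst_pair hu hv dvd_rfl (dvd_mul_right _ _) fun d hd => ?_
    rw [map_sub, hcoeff] at hd
    split_ifs at hd with h
    · exact absurd (sub_self _) hd
    · rw [sub_zero] at hd
      have h1 := hw d hd
      rw [mem_edgeSet hb hc] at h
      omega
  set E : MvPowerSeries (Fin 2) ℂ := ∑ d ∈ edgeSet b c k,
    MvPowerSeries.C (MvPowerSeries.coeff d f) * (varY + MvPowerSeries.C α) ^ d 1 with hE
  have htop' : MvPowerSeries.subst a top = varX ^ (c * k) * E := by
    rw [htop, ← MvPowerSeries.coe_substAlgHom hs, map_sum, hE, Finset.mul_sum]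
    refine Finset.sum_congr rfl fun d hd => ?_
    rw [MvPowerSeries.coe_substAlgHom hs, MvPowerSeries.subst_monomial hs,
      Finsupp.prod_fintype _ _ (fun _ => pow_zero _), Fin.prod_univ_two,
      ← MvPowerSeries.c_eq_algebraMap]
    rw [mem_edgeSet hb hc] at hd
    change _ * ((varX ^ b) ^ d 0 * (varX ^ c * (varY + MvPowerSeries.C α)) ^ d 1) = _
    rw [← hd, mul_pow]
    ring
  have hW : MvPowerSeries.subst a f = varX ^ (c * k) * (E + varX * R) := by
    have h1 : f = top + (f - top) := by ring
    conv_lhs => rw [h1]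
    rw [MvPowerSeries.subst_add hs, htop', hR]
    ring
  refine ⟨E + varX * R, ?_, hW, fun i => ?_⟩
  · refine IsConvergentSeries.of_X_pow_mul (s := 0) (n := c * k) ?_
    rw [← hW]
    exact hf.subst_pair ((IsConvergentSeries.X 0).pow b) (((IsConvergentSeries.X 0).pow c).mul
      ((IsConvergentSeries.X 1).add (IsConvergentSeries.C α))) hu hv
  · have h0 : MvPowerSeries.HasSubst ![0, (PowerSeries.X : PowerSeries ℂ)] :=
      hasSubst_pair (map_zero _) (MvPowerSeries.constantCoeff_X ())
    rw [← psubst_zero_X_coeff, ← Polynomial.coeff_coe]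
    congr 1
    rw [MvPowerSeries.subst_add h0, MvPowerSeries.subst_mul h0, subst_pair_varX h0, zero_mul,
      add_zero, hE, ← MvPowerSeries.coe_substAlgHom h0, map_sum, edgePoly,
      ← Polynomial.coe_compRingHom_apply, map_sum]
    rw [← Polynomial.coeToPowerSeries.ringHom_apply, map_sum]
    refine Finset.sum_congr rfl fun d _ => ?_
    rw [MvPowerSeries.coe_substAlgHom h0, MvPowerSeries.subst_mul h0, MvPowerSeries.subst_pow h0,
      MvPowerSeries.subst_add h0, subst_pair_varY h0, MvPowerSeries.subst_C, MvPowerSeries.subst_C,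
      Polynomial.coe_compRingHom_apply, Polynomial.monomial_comp,
      Polynomial.coeToPowerSeries.ringHom_apply]
    push_cast
    rfl

end edge

/-- A polynomial of degree `k + 1` having a root of full multiplicity is `a(X - α)^(k+1)`. A
vanishing coefficient of `X^k` then forces `α = 0`, leaving no lower terms. Hence any root has
multiplicity `l + 1 ≤ k`, and the induction of Newton-Puiseux descends. -/
theorem exists_root_multiplicity_lt {Q : Polynomial ℂ} {k : ℕ} (hdeg : Q.natDegree ≤ k + 1)
    (hk : Q.coeff (k + 1) ≠ 0) (hk1 : Q.coeff k = 0) (hi : ∃ i < k + 1, Q.coeff i ≠ 0) :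
    ∃ (α : ℂ) (l : ℕ), l < k ∧
      (Q.comp (Polynomial.X + Polynomial.C α)).coeff (l + 1) ≠ 0 ∧
      ∀ i < l + 1, (Q.comp (Polynomial.X + Polynomial.C α)).coeff i = 0 := by
  have hQ : Q ≠ 0 := by
    rintro rfl
    simp at hk
  have hn : Q.natDegree = k + 1 := le_antisymm hdeg (Polynomial.le_natDegree_of_ne_zero hk)
  obtain ⟨α, hα⟩ := IsAlgClosed.exists_root Q (by
    rw [Polynomial.degree_eq_natDegree hQ, hn]
    exact_mod_cast k.succ_ne_zero)
  obtain ⟨R, hR, hRd⟩ := Polynomial.exists_eq_pow_rootMultiplicity_mul_and_not_dvd Q hQ α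
  have hl := (Polynomial.rootMultiplicity_pos hQ).2 hα
  set l := Polynomial.rootMultiplicity α Q with hldef
  have hR0 : R ≠ 0 := by
    rintro rfl
    simp at hRd
  have hdl : k + 1 = l + R.natDegree := by
    rw [← hn]
    conv_lhs => rw [hR]
    rw [Polynomial.natDegree_mul (pow_ne_zero _ (Polynomial.X_sub_C_ne_zero α)) hR0,
      Polynomial.natDegree_pow, Polynomial.natDegree_X_sub_C, mul_one]
  have hlk : l ≠ k + 1 := by
    intro h
    rw [h] at hR hdl
    obtain ⟨a, rfl⟩ := Polynomial.natDegree_eq_zero.1 (by omega : R.natDegree = 0)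
    have ha : a ≠ 0 := by simpa using hR0
    have hco : ∀ i, Q.coeff i = (-α) ^ (k + 1 - i) * ((k + 1).choose i : ℂ) * a := by
      intro i
      conv_lhs => rw [hR]
      rw [Polynomial.coeff_mul_C, sub_eq_add_neg, ← Polynomial.C_neg,
        Polynomial.coeff_X_add_C_pow]
    have h0 : α = 0 := by
      rw [hco] at hk1
      have : k + 1 - k = 1 := by omega
      rw [this] at hk1
      have h2 : (k : ℂ) + 1 ≠ 0 := by exact_mod_cast k.succ_ne_zero
      simpa [ha, h2] using hk1
    obtain ⟨i, hik, hi⟩ := hi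
    apply hi
    rw [hco, h0, neg_zero, zero_pow (by omega), zero_mul, zero_mul]
  have hcomp : Q.comp (Polynomial.X + Polynomial.C α) =
      Polynomial.X ^ l * R.comp (Polynomial.X + Polynomial.C α) := by
    conv_lhs => rw [hR]
    rw [Polynomial.mul_comp, Polynomial.pow_comp, Polynomial.sub_comp, Polynomial.X_comp,
      Polynomial.C_comp, add_sub_cancel_right]
  obtain ⟨l', hl'⟩ : ∃ l', l = l' + 1 := ⟨l - 1, by omega⟩
  refine ⟨α, l', by omega, ?_, fun i hi => ?_⟩
  · rw [hcomp, ← hl', Polynomial.coeff_X_pow_mul', if_pos le_rfl, Nat.sub_self,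
      Polynomial.coeff_zero_eq_eval_zero, Polynomial.eval_comp]
    rw [Polynomial.dvd_iff_isRoot] at hRd
    simpa using hRd
  · rw [hcomp, Polynomial.coeff_X_pow_mul', if_neg (by omega)]

/-- The steepest edge of the Newton polygon that meets `y^k`. -/
theorem exists_edge {f : MvPowerSeries (Fin 2) ℂ} {k : ℕ} (hf : HasYOrder f k)
    (h : ∃ d : Fin 2 →₀ ℕ, d 1 < k ∧ MvPowerSeries.coeff d f ≠ 0) :
    ∃ e : Fin 2 →₀ ℕ, e 1 < k ∧ MvPowerSeries.coeff e f ≠ 0 ∧ 0 < e 0 ∧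
      ∀ d, MvPowerSeries.coeff d f ≠ 0 → e 0 * k ≤ (k - e 1) * d 0 + e 0 * d 1 := by
  -- The point minimizes the slope `d 0 / (k - d 1)`; multiplication by `k!` keeps the slope a
  -- natural number.
  obtain ⟨e, ⟨hek, he⟩, hmin⟩ := (measure fun d : Fin 2 →₀ ℕ =>
    d 0 * (k.factorial / (k - d 1))).wf.has_min
    {d | d 1 < k ∧ MvPowerSeries.coeff d f ≠ 0} h
  refine ⟨e, hek, he, ?_, fun d hd => ?_⟩
  · by_contra h0
    have : e = Finsupp.single 1 (e 1) := by
      ext s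
      fin_cases s
      · simpa using h0
      · simp
    rw [this] at he
    exact he (hf.2 _ hek)
  · rcases le_or_gt k (d 1) with hdk | hdk
    · nlinarith [Nat.mul_le_mul_left (e 0) hdk]
    · have h1 : e 0 * (k.factorial / (k - e 1)) ≤ d 0 * (k.factorial / (k - d 1)) :=
        not_lt.1 (hmin d ⟨hdk, hd⟩)
      have h2 : k.factorial / (k - e 1) * (k - e 1) = k.factorial :=
        Nat.div_mul_cancel (Nat.dvd_factorial (by omega) (by omega))
      have h3 : k.factorial / (k - d 1) * (k - d 1) = k.factorial :=
        Nat.div_mul_cancel (Nat.dvd_factorial (by omega) (by omega))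
      have h4 : e 0 * (k - d 1) ≤ (k - e 1) * d 0 := by
        refine Nat.le_of_mul_le_mul_left ?_ k.factorial_pos
        calc k.factorial * (e 0 * (k - d 1))
            = e 0 * (k.factorial / (k - e 1)) * ((k - e 1) * (k - d 1)) := by
              conv_lhs => rw [← h2]
              ring
          _ ≤ d 0 * (k.factorial / (k - d 1)) * ((k - e 1) * (k - d 1)) :=
              Nat.mul_le_mul_right _ h1
          _ = k.factorial * ((k - e 1) * d 0) := by
              conv_rhs => rw [← h3]
              ring
      have h5 : e 0 * k = e 0 * (k - d 1) + e 0 * d 1 := by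
        rw [← mul_add, Nat.sub_add_cancel hdk.le]
      omega

/-- The theorem of Newton and Puiseux: a convergent power series vanishing at the origin, but not
along the `y`-axis, has a convergent Puiseux series as a root. -/
theorem exists_puiseux_root (k : ℕ) {f : MvPowerSeries (Fin 2) ℂ} (hc : IsConvergentSeries f)
    (hf : HasYOrder f (k + 1)) :
    ∃ (n : ℕ) (φ : PowerSeries ℂ), 0 < n ∧ IsConvergentSeries φ ∧
      PowerSeries.constantCoeff φ = 0 ∧
      MvPowerSeries.subst ![(PowerSeries.X : PowerSeries ℂ) ^ n, φ] f = (0 : PowerSeries ℂ) := by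
  induction k using Nat.strong_induction_on generalizing f with
  | _ k ih =>
  -- Killing the `y^k` terms first ensures that the edge polynomial is not a pure power of a linear
  -- form, so the blow-up has strictly smaller order.
  obtain ⟨g, hg, hg0, hgk⟩ := hf.exists_shift hc
  have hf1 := hf.subst_shift hg0
  have hc1 := hc.subst_shift hg hg0
  set f₁ := MvPowerSeries.subst ![varX, varY + inX g] f with hf₁
  by_cases hz : ∃ d : Fin 2 →₀ ℕ, d 1 < k + 1 ∧ MvPowerSeries.coeff d f₁ ≠ 0
  · obtain ⟨e, hek, he, he0, hw⟩ := exists_edge hf1 hz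
    have hb : 0 < k + 1 - e 1 := by omega
    set b := k + 1 - e 1 with hbdef
    set c := e 0 with hcdef
    have hedge : b * e 0 + c * e 1 = c * (k + 1) := by
      rw [← hcdef, mul_comm b c, ← mul_add, hbdef, Nat.sub_add_cancel hek.le]
    obtain ⟨α, l, hlk, hl, hl'⟩ := exists_root_multiplicity_lt
      (Q := edgePoly f₁ b c (k + 1)) (k := k)
      (natDegree_edgePoly_le hb he0)
      (by
        have h1 := coeff_edgePoly (f := f₁) (d := Finsupp.single 1 (k + 1)) (k := k + 1) hb he0
          (by simp)
        rw [Finsupp.single_eq_same] at h1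
        rw [h1]
        exact hf1.1)
      (coeff_edgePoly_eq_zero hgk)
      ⟨e 1, hek, by rwa [coeff_edgePoly hb he0 hedge]⟩
    obtain ⟨V, hVc, hVW, hV⟩ := exists_edge_transform hc1 hb he0 hw α
    obtain ⟨n, φ, hn, hφ, hφ0, hroot⟩ := ih l hlk hVc
      ⟨by rwa [hV], fun i hi => by rw [hV, hl' i hi]⟩
    have hX : MvPowerSeries.constantCoeff ((PowerSeries.X : PowerSeries ℂ) ^ n) = 0 :=
      constantCoeff_X_pow () hn
    have hs := hasSubst_pair hX hφ0
    have hnb : 0 < n * b := Nat.mul_pos hn hb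
    have hnc : 0 < n * c := Nat.mul_pos hn he0
    have h1 : MvPowerSeries.subst ![(PowerSeries.X : PowerSeries ℂ) ^ (n * b),
        (PowerSeries.X : PowerSeries ℂ) ^ (n * c) * (φ + PowerSeries.C α)] f₁ =
        (0 : PowerSeries ℂ) := by
      have h2 := congrArg (MvPowerSeries.subst ![(PowerSeries.X : PowerSeries ℂ) ^ n, φ]) hVW
      rw [MvPowerSeries.subst_mul hs, hroot, mul_zero, subst_subst_pair (hasSubst_pair
        (constantCoeff_X_pow 0 hb) (constantCoeff_X_pow_mul 0 he0 _)) hs,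
        MvPowerSeries.subst_pow hs, MvPowerSeries.subst_mul hs, MvPowerSeries.subst_pow hs,
        MvPowerSeries.subst_add hs, subst_pair_varX hs, subst_pair_varY hs,
        MvPowerSeries.subst_C, ← pow_mul, ← pow_mul] at h2
      exact h2
    have hX' : MvPowerSeries.constantCoeff ((PowerSeries.X : PowerSeries ℂ) ^ (n * b)) = 0 :=
      constantCoeff_X_pow () hnb
    have hXc : ∀ j, IsConvergentSeries ((PowerSeries.X : PowerSeries ℂ) ^ j) := fun j =>
      (IsConvergentSeries.X ()).pow j
    have hY : MvPowerSeries.constantCoeff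
        ((PowerSeries.X : PowerSeries ℂ) ^ (n * c) * (φ + PowerSeries.C α)) = 0 :=
      constantCoeff_X_pow_mul () hnc _
    -- Undo the blow-up, with `x = t^(nb)` and `y = t^(nc)(φ(t) + α)`, and then the Tschirnhausen
    -- shift, which adds `g(t^(nb))`.
    refine ⟨n * b, (PowerSeries.X : PowerSeries ℂ) ^ (n * c) * (φ + PowerSeries.C α) +
      PowerSeries.subst ((PowerSeries.X : PowerSeries ℂ) ^ (n * b)) g, hnb, ?_, ?_, ?_⟩
    · exact ((hXc _).mul (hφ.add (IsConvergentSeries.C α))).add (hg.psubst (hXc _) hX')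
    · rw [map_add]
      exact (congrArg₂ (· + ·) hY ((constantCoeff_psubst hX' g).trans hg0)).trans (add_zero 0)
    · rw [← h1, hf₁, subst_subst_shift hg0 hX' hY]
  -- No monomial of `f₁` has `y`-degree below `k + 1`, so `y = 0` is a root of `f₁` and `y = g(x)` a
  -- root of `f`.
  · refine ⟨1, g, one_pos, hg, hg0, ?_⟩
    have h1 := psubst_X_subst_shift hg0 (map_zero _) f
    rw [zero_add, ← hf₁] at h1
    rw [pow_one, ← h1]
    ext j
    rw [psubst_X_zero_coeff, map_zero]
    by_contra hne
    exact hz ⟨_, by simp, hne⟩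

/-! ### Ramification `x = t^n` and Puiseux factors as roots -/

theorem exists_add_eq_of_coeff_mul_ne_zero {σ : Type*} {f g : MvPowerSeries σ ℂ} {e : σ →₀ ℕ}
    (h : MvPowerSeries.coeff e (f * g) ≠ 0) :
    ∃ a b : σ →₀ ℕ, a + b = e ∧ MvPowerSeries.coeff a f ≠ 0 ∧ MvPowerSeries.coeff b g ≠ 0 := by
  classical
  rw [MvPowerSeries.coeff_mul] at h
  obtain ⟨x, hx, hne⟩ := Finset.exists_ne_zero_of_sum_ne_zero h
  exact ⟨x.1, x.2, Finset.HasAntidiagonal.mem_antidiagonal.1 hx, left_ne_zero_of_mul hne,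
    right_ne_zero_of_mul hne⟩

theorem constantCoeff_pX_pow {n : ℕ} (hn : 0 < n) :
    MvPowerSeries.constantCoeff ((PowerSeries.X : PowerSeries ℂ) ^ n) = 0 :=
  constantCoeff_X_pow () hn

theorem isConvergentSeries_pX_pow (n : ℕ) :
    IsConvergentSeries ((PowerSeries.X : PowerSeries ℂ) ^ n) :=
  (IsConvergentSeries.X ()).pow n

section ramification

variable {n : ℕ}

theorem hasSubst_ramify (hn : 0 < n) : MvPowerSeries.HasSubst ![varX ^ n, varY] :=
  hasSubst_pair (constantCoeff_X_pow 0 hn) (MvPowerSeries.constantCoeff_X 1)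

theorem IsConvergentSeries.ramify {f : MvPowerSeries (Fin 2) ℂ} (hf : IsConvergentSeries f)
    (hn : 0 < n) : IsConvergentSeries (MvPowerSeries.subst ![varX ^ n, varY] f) :=
  hf.subst_pair ((IsConvergentSeries.X 0).pow n) (IsConvergentSeries.X 1)
    (constantCoeff_X_pow 0 hn) (MvPowerSeries.constantCoeff_X 1)

theorem subst_pair_ramify {τ : Type*} {u v : MvPowerSeries τ ℂ} (hn : 0 < n)
    (hs : MvPowerSeries.HasSubst ![u, v]) (f : MvPowerSeries (Fin 2) ℂ) :
    MvPowerSeries.subst ![u, v] (MvPowerSeries.subst ![varX ^ n, varY] f) =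
      MvPowerSeries.subst ![u ^ n, v] f := by
  rw [subst_subst_pair (hasSubst_ramify hn) hs, MvPowerSeries.subst_pow hs, subst_pair_varX hs,
    subst_pair_varY hs]

theorem coeff_subst_ramify (hn : 0 < n) (f : MvPowerSeries (Fin 2) ℂ) (e : Fin 2 →₀ ℕ) :
    MvPowerSeries.coeff e (MvPowerSeries.subst ![varX ^ n, varY] f) =
      finsum fun d : Fin 2 →₀ ℕ => MvPowerSeries.coeff d f • MvPowerSeries.coeff e
        (MvPowerSeries.monomial (Finsupp.single 0 (n * d 0) + Finsupp.single 1 (d 1)) (1 : ℂ)) := by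
  rw [MvPowerSeries.coeff_subst (hasSubst_ramify hn)]
  refine finsum_congr fun d => ?_
  congr 2
  rw [Finsupp.prod_fintype _ _ (fun _ => pow_zero _), Fin.prod_univ_two]
  change (varX ^ n) ^ d 0 * varY ^ d 1 = _
  rw [← pow_mul, MvPowerSeries.X_pow_eq, MvPowerSeries.X_pow_eq,
    MvPowerSeries.monomial_mul_monomial, one_mul]

theorem coeff_ramify (hn : 0 < n) (f : MvPowerSeries (Fin 2) ℂ) (d : Fin 2 →₀ ℕ) :
    MvPowerSeries.coeff (Finsupp.single 0 (n * d 0) + Finsupp.single 1 (d 1))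
      (MvPowerSeries.subst ![varX ^ n, varY] f) = MvPowerSeries.coeff d f := by
  rw [coeff_subst_ramify hn, finsum_eq_single _ d]
  · rw [MvPowerSeries.coeff_monomial_same, smul_eq_mul, mul_one]
  · intro e hne
    rw [MvPowerSeries.coeff_monomial_ne, smul_zero]
    intro h
    apply hne
    have h0 := DFunLike.congr_fun h 0
    have h1 := DFunLike.congr_fun h 1
    simp at h0 h1
    ext s
    fin_cases s
    · exact (h0.resolve_right hn.ne').symm
    · exact h1.symm

theorem coeff_ramify_of_not_dvd (hn : 0 < n) (f : MvPowerSeries (Fin 2) ℂ) {e : Fin 2 →₀ ℕ}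
    (he : ¬ n ∣ e 0) : MvPowerSeries.coeff e (MvPowerSeries.subst ![varX ^ n, varY] f) = 0 := by
  rw [coeff_subst_ramify hn]
  refine finsum_eq_zero_of_forall_eq_zero fun d => ?_
  rw [MvPowerSeries.coeff_monomial_ne, smul_zero]
  rintro rfl
  simp at he

theorem coeff_single_one_ramify (hn : 0 < n) (f : MvPowerSeries (Fin 2) ℂ) (i : ℕ) :
    MvPowerSeries.coeff (Finsupp.single 1 i) (MvPowerSeries.subst ![varX ^ n, varY] f) =
      MvPowerSeries.coeff (Finsupp.single 1 i) f := by
  simpa using coeff_ramify hn f (Finsupp.single 1 i)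

theorem subst_pair_varY_add_inX {τ : Type*} {u v : MvPowerSeries τ ℂ}
    (hs : MvPowerSeries.HasSubst ![u, v]) (ψ : PowerSeries ℂ) :
    MvPowerSeries.subst ![u, v] (varY + inX ψ) = v + PowerSeries.subst u ψ := by
  rw [MvPowerSeries.subst_add hs, subst_pair_varY hs, subst_pair_inX hs]

theorem hasSubst_psubst {g : PowerSeries ℂ} (hg : PowerSeries.constantCoeff g = 0) :
    MvPowerSeries.HasSubst ![(PowerSeries.X : PowerSeries ℂ), g] :=
  hasSubst_pair (MvPowerSeries.constantCoeff_X ()) hg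

theorem psubst_varY_add_inX {g : PowerSeries ℂ} (hg : PowerSeries.constantCoeff g = 0)
    (ψ : PowerSeries ℂ) :
    MvPowerSeries.subst ![(PowerSeries.X : PowerSeries ℂ), g] (varY + inX ψ) = g + ψ :=
  (subst_pair_varY_add_inX (hasSubst_psubst hg) ψ).trans
    (congrArg (fun z : PowerSeries ℂ => g + z) (PowerSeries.X_subst ψ))

theorem constantCoeff_neg_eq_zero {φ : PowerSeries ℂ} (hφ : PowerSeries.constantCoeff φ = 0) :
    PowerSeries.constantCoeff (-φ) = 0 := by rw [map_neg, hφ, neg_zero]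

theorem psubst_neg_eq_zero_of_dvd {f : MvPowerSeries (Fin 2) ℂ} {φ : PowerSeries ℂ}
    (hφ : PowerSeries.constantCoeff φ = 0) (h : varY + inX φ ∣ f) :
    MvPowerSeries.subst ![(PowerSeries.X : PowerSeries ℂ), -φ] f = (0 : PowerSeries ℂ) := by
  obtain ⟨q, rfl⟩ := h
  have hφ' := constantCoeff_neg_eq_zero hφ
  rw [MvPowerSeries.subst_mul (hasSubst_psubst hφ'), psubst_varY_add_inX hφ', neg_add_cancel]
  exact zero_mul _

/-- The factor theorem for `p(t^n, y)`; convergence of the cofactor is automatic. -/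
theorem isPuiseuxFactor_iff {p : ConvXY} {φ : PowerSeries ℂ} :
    IsPuiseuxFactor p n φ ↔ 0 < n ∧ IsConvergentSeries φ ∧ PowerSeries.constantCoeff φ = 0 ∧
      MvPowerSeries.subst ![(PowerSeries.X : PowerSeries ℂ) ^ n, -φ]
        (p : MvPowerSeries (Fin 2) ℂ) = (0 : PowerSeries ℂ) := by
  constructor
  · rintro ⟨hn, hφ, hφ0, q, hq⟩
    refine ⟨hn, hφ, hφ0, ?_⟩
    rw [← psubst_neg_eq_zero_of_dvd hφ0 ⟨_, hq⟩]
    exact (subst_pair_ramify hn (hasSubst_psubst (constantCoeff_neg_eq_zero hφ0)) _).symm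
  · rintro ⟨hn, hφ, hφ0, h⟩
    obtain ⟨q, hq, hqc⟩ := exists_eq_mul_of_psubst_eq_zero
      (f := MvPowerSeries.subst ![varX ^ n, varY] (p : MvPowerSeries (Fin 2) ℂ)) hφ0
      ((subst_pair_ramify hn (hasSubst_psubst (constantCoeff_neg_eq_zero hφ0)) _).trans h)
    exact ⟨hn, hφ, hφ0, ⟨q, hqc (IsConvergentSeries.ramify p.2 hn) hφ⟩, hq⟩

end ramification

/-! ### Orders of roots and the Newton polygon -/

/-- All Puiseux roots `y = ψ(x^{1/n})` of `P` have order greater than `M`. -/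
def PuiseuxRootsOrderGT (P : MvPowerSeries (Fin 2) ℂ) (M : ℕ) : Prop :=
  ∀ (n : ℕ) (ψ : PowerSeries ℂ), 0 < n → IsConvergentSeries ψ →
    PowerSeries.constantCoeff ψ = 0 →
    MvPowerSeries.subst ![(PowerSeries.X : PowerSeries ℂ) ^ n, ψ] P = (0 : PowerSeries ℂ) →
    PowerSeries.X ^ (n * M + 1) ∣ ψ

/-- The Newton polygon of `P` lies strictly above the segment of slope `M` at `y^k`. -/
def NewtonPolygonAbove (P : MvPowerSeries (Fin 2) ℂ) (k M : ℕ) : Prop :=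
  ∀ d : Fin 2 →₀ ℕ, d 1 < k → MvPowerSeries.coeff d P ≠ 0 → M * (k - d 1) < d 0

/-- On `x = 0` the factorization reads `P(0, y) = y q(0, y)`. -/
theorem HasYOrder.of_ramify_eq_mul {P q : MvPowerSeries (Fin 2) ℂ} {φ : PowerSeries ℂ} {n k : ℕ}
    (hP : HasYOrder P (k + 1)) (hn : 0 < n) (hφ : PowerSeries.constantCoeff φ = 0)
    (h : MvPowerSeries.subst ![varX ^ n, varY] P = (varY + inX φ) * q) : HasYOrder q k := by
  have hs : MvPowerSeries.HasSubst ![0, (PowerSeries.X : PowerSeries ℂ)] :=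
    hasSubst_pair (map_zero _) (MvPowerSeries.constantCoeff_X ())
  have key : ∀ i, MvPowerSeries.coeff (Finsupp.single 1 i) q =
      MvPowerSeries.coeff (Finsupp.single 1 (i + 1)) P := by
    intro i
    have h0 : PowerSeries.subst (0 : PowerSeries ℂ) φ = (0 : PowerSeries ℂ) :=
      PowerSeries.subst_zero_of_constantCoeff_zero hφ
    have h1 : MvPowerSeries.subst ![0, (PowerSeries.X : PowerSeries ℂ)] ((varY + inX φ) * q) =
        PowerSeries.X * MvPowerSeries.subst ![0, (PowerSeries.X : PowerSeries ℂ)] q := by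
      rw [MvPowerSeries.subst_mul hs, MvPowerSeries.subst_add hs, subst_pair_varY hs,
        subst_pair_inX hs]
      refine (congrArg (fun z : PowerSeries ℂ => (PowerSeries.X + z) * _) h0).trans ?_
      change (PowerSeries.X + 0) * _ = _
      rw [add_zero]
    rw [← coeff_single_one_ramify hn P, h, ← psubst_zero_X_coeff, ← psubst_zero_X_coeff, h1,
      PowerSeries.coeff_succ_X_mul]
  exact ⟨by rw [key]; exact hP.1, fun i hi => by rw [key]; exact hP.2 _ (by omega)⟩

/-- Induction on the `y`-order: dividing `P(t^n, y)` by one root leaves a series `q` of smaller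
`y`-order. The roots of `q` are roots of `P` after further ramification, so their orders exceed `n
M`. Multiplying `q` back by `y` plus a series of order greater than `n M` keeps the polygon above
the segment. -/
theorem NewtonPolygonAbove.of_puiseuxRootsOrderGT {k : ℕ} {P : MvPowerSeries (Fin 2) ℂ} {M : ℕ}
    (hc : IsConvergentSeries P) (hP : HasYOrder P k) (h : PuiseuxRootsOrderGT P M) :
    NewtonPolygonAbove P k M := by
  induction k generalizing P M with
  | zero => exact fun d hd => absurd hd (Nat.not_lt_zero _)
  | succ k ih =>
    obtain ⟨n, φ, hn, hφ, hφ0, hroot⟩ := exists_puiseux_root k hc hP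
    have hφ0' : PowerSeries.constantCoeff (-φ) = 0 := by rw [map_neg, hφ0, neg_zero]
    have hord := h n φ hn hφ hφ0 hroot
    obtain ⟨q, hq, hqc⟩ := exists_eq_mul_of_psubst_eq_zero
      (f := MvPowerSeries.subst ![varX ^ n, varY] P) hφ0' (by
        rw [neg_neg]
        exact (subst_pair_ramify hn (hasSubst_pair (MvPowerSeries.constantCoeff_X ()) hφ0)
          _).trans hroot)
    have hqN : NewtonPolygonAbove q k (n * M) := by
      refine ih (hqc (hc.ramify hn) hφ.neg) (hP.of_ramify_eq_mul hn hφ0' hq) ?_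
      intro n' ψ hn' hψ hψ0 hψr
      have hs : MvPowerSeries.HasSubst ![(PowerSeries.X : PowerSeries ℂ) ^ n', ψ] :=
        hasSubst_pair (constantCoeff_pX_pow hn') hψ0
      rw [← mul_assoc]
      refine h (n' * n) ψ (Nat.mul_pos hn' hn) hψ hψ0 ?_
      rw [pow_mul]
      refine (subst_pair_ramify hn hs P).symm.trans ?_
      rw [hq, MvPowerSeries.subst_mul hs, hψr, mul_zero]
    intro d hd hne
    rw [← coeff_ramify hn, hq, add_mul, map_add] at hne
    have hE : MvPowerSeries.coeff (Finsupp.single 0 (n * d 0) + Finsupp.single 1 (d 1))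
        (varY * q) ≠ 0 ∨ MvPowerSeries.coeff (Finsupp.single 0 (n * d 0) + Finsupp.single 1 (d 1))
        (inX (-φ) * q) ≠ 0 := by
      by_contra! hcon
      rw [hcon.1, hcon.2, add_zero] at hne
      exact hne rfl
    -- The exponent of `x` in `P` is multiplied by `n` in `P(t^n, y)`, so the inequality is proved
    -- after scaling by `n`.
    refine Nat.lt_of_mul_lt_mul_left (a := n) ?_
    rw [← mul_assoc]
    rcases hE with hE | hE <;> obtain ⟨a, b, hab, ha, hb⟩ := exists_add_eq_of_coeff_mul_ne_zero hE
      <;> have h0 := DFunLike.congr_fun hab 0 <;> have h1 := DFunLike.congr_fun hab 1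
      <;> simp at h0 h1
    · have ha1 : a = Finsupp.single 1 1 := by
        classical
        by_contra hne1
        rw [MvPowerSeries.coeff_X, if_neg hne1] at ha
        exact ha rfl
      rw [ha1] at h0 h1
      simp at h0 h1
      have := hqN b (by omega) hb
      rw [h0] at this
      have e1 : k - b 1 = k + 1 - d 1 := by omega
      rwa [e1] at this
    · rw [coeff_inX] at ha
      split_ifs at ha with ha1
      · have ha0 : n * M + 1 ≤ a 0 := by
          by_contra hlt
          apply ha
          rw [map_neg, PowerSeries.X_pow_dvd_iff.1 hord (a 0) (by omega), neg_zero]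
        have hb1 : b 1 = d 1 := by omega
        rcases Nat.lt_or_ge (b 1) k with hlt | hge
        · have h2 := hqN b hlt hb
          have e1 : k + 1 - d 1 = k - b 1 + 1 := by omega
          rw [e1, mul_add, mul_one]
          omega
        -- Here `d 1 = k`; the polygon of `q` says nothing, but the order of `φ` alone suffices.
        · have e1 : k + 1 - d 1 = 1 := by omega
          rw [e1]
          omega
      · exact absurd rfl ha

/-- On a root, `c ψ^k` equals minus the sum of all other terms. If `t^j ∣ ψ` with `1 ≤ j ≤ nM`, each
of those terms has order greater than `jk`; hence so does `ψ^k`, and `t^(j+1) ∣ ψ`. -/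
theorem NewtonPolygonAbove.puiseuxRootsOrderGT {k : ℕ} {P : MvPowerSeries (Fin 2) ℂ} {M : ℕ}
    (hP : HasYOrder P k) (h : NewtonPolygonAbove P k M) : PuiseuxRootsOrderGT P M := by
  classical
  intro n ψ hn _ hψ0 hroot
  have hs : MvPowerSeries.HasSubst ![(PowerSeries.X : PowerSeries ℂ) ^ n, ψ] :=
    hasSubst_pair (constantCoeff_pX_pow hn) hψ0
  set c := MvPowerSeries.coeff (Finsupp.single 1 k) P
  set a := P - MvPowerSeries.C c * varY ^ k with ha
  have hca : ∀ d : Fin 2 →₀ ℕ, MvPowerSeries.coeff d a =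
      if d = Finsupp.single 1 k then 0 else MvPowerSeries.coeff d P := by
    intro d
    rw [ha, map_sub, MvPowerSeries.coeff_C_mul, MvPowerSeries.coeff_X_pow]
    split_ifs with hd
    · rw [hd, mul_one, sub_self]
    · rw [mul_zero, sub_zero]
  have key : ∀ j, j ≤ n * M + 1 → (PowerSeries.X : PowerSeries ℂ) ^ j ∣ ψ := by
    intro j
    induction j with
    | zero => simp
    | succ j ih =>
      intro hj
      -- For `j = 0` the terms with `y`-exponent above `k` yield no gain, so the start comes from
      -- `ψ(0) = 0`.
      rcases Nat.eq_zero_or_pos j with rfl | hj0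
      · rw [zero_add, pow_one]
        exact PowerSeries.X_dvd_iff.2 hψ0
      obtain ⟨w, hw⟩ := ih (by omega)
      have h1 : (PowerSeries.X : PowerSeries ℂ) ^ (j * k + 1) ∣
          MvPowerSeries.subst ![(PowerSeries.X : PowerSeries ℂ) ^ n, ψ] a := by
        refine X_pow_dvd_subst_pair (s := ()) (b := n) (c := j) (constantCoeff_pX_pow hn) hψ0
          dvd_rfl ⟨w, hw⟩ fun d hd => ?_
        rw [hca] at hd
        split_ifs at hd with hd1
        · exact absurd rfl hd
        · rcases lt_trichotomy (d 1) k with hlt | heq | hgt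
          · have h2 := h d hlt hd
            obtain ⟨t, ht⟩ : ∃ t, k = d 1 + t := ⟨k - d 1, by omega⟩
            rw [ht, Nat.add_sub_cancel_left] at h2
            rw [ht]
            have h3 : n * (M * t + 1) ≤ n * d 0 := Nat.mul_le_mul_left n h2
            have h4 : j * t ≤ n * M * t := Nat.mul_le_mul_right t (by omega)
            nlinarith
          · have : 0 < d 0 := by
              by_contra h0
              apply hd1
              ext s
              fin_cases s
              · simpa using h0
              · simp [heq]
            have : 0 < n * d 0 := Nat.mul_pos hn this
            rw [heq]
            omega
          · have : j * (k + 1) ≤ j * d 1 := Nat.mul_le_mul_left j hgt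
            rw [mul_add] at this
            omega
      have h2 : MvPowerSeries.subst ![(PowerSeries.X : PowerSeries ℂ) ^ n, ψ] a =
          -(PowerSeries.C c * ψ ^ k) := by
        rw [ha, MvPowerSeries.subst_sub hs, hroot, MvPowerSeries.subst_mul hs,
          MvPowerSeries.subst_C, MvPowerSeries.subst_pow hs, subst_pair_varY hs]
        exact zero_sub _
      rw [h2, dvd_neg] at h1
      have hcu : IsUnit (PowerSeries.C c : PowerSeries ℂ) := (IsUnit.mk0 c hP.1).map _
      rw [hcu.dvd_mul_left, hw, mul_pow, ← pow_mul, pow_succ] at h1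
      have h3 := (mul_dvd_mul_iff_left (pow_ne_zero _ PowerSeries.X_ne_zero)).1 h1
      have h4 := PowerSeries.X_prime.dvd_of_dvd_pow h3
      rw [hw, pow_succ]
      exact mul_dvd_mul_left _ h4
  exact key _ le_rfl

/-! ### Conjugation by roots of unity -/

/-- The ring endomorphism `f(x, y) ↦ f(a x, y)`. -/
noncomputable def scaleX (a : ℂ) : MvPowerSeries (Fin 2) ℂ →+* MvPowerSeries (Fin 2) ℂ :=
  MvPowerSeries.rescale ![a, 1]

theorem coeff_scaleX (a : ℂ) (f : MvPowerSeries (Fin 2) ℂ) (d : Fin 2 →₀ ℕ) :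
    MvPowerSeries.coeff d (scaleX a f) = a ^ d 0 * MvPowerSeries.coeff d f := by
  rw [scaleX, MvPowerSeries.coeff_rescale, Finsupp.prod_fintype _ _ (fun _ => pow_zero _),
    Fin.prod_univ_two]
  simp

theorem scaleX_inX (a : ℂ) (φ : PowerSeries ℂ) :
    scaleX a (inX φ) = inX (PowerSeries.rescale a φ) := by
  ext d
  rw [coeff_scaleX, coeff_inX, coeff_inX, PowerSeries.coeff_rescale]
  split_ifs
  exacts [rfl, mul_zero _]

theorem scaleX_varY (a : ℂ) : scaleX a varY = varY := by
  classical
  ext d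
  rw [coeff_scaleX, MvPowerSeries.coeff_X]
  split_ifs with h
  · rw [h]
    simp
  · rw [mul_zero]

theorem scaleX_varY_add_inX (a : ℂ) (φ : PowerSeries ℂ) :
    scaleX a (varY + inX φ) = varY + inX (PowerSeries.rescale a φ) := by
  rw [map_add, scaleX_inX, scaleX_varY]

theorem scaleX_ramify {n : ℕ} (hn : 0 < n) {a : ℂ} (ha : a ^ n = 1)
    (f : MvPowerSeries (Fin 2) ℂ) :
    scaleX a (MvPowerSeries.subst ![varX ^ n, varY] f) =
      MvPowerSeries.subst ![varX ^ n, varY] f := by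
  ext d
  rw [coeff_scaleX]
  by_cases hd : n ∣ d 0
  · obtain ⟨t, ht⟩ := hd
    rw [ht, pow_mul, ha, one_pow, one_mul]
  · rw [coeff_ramify_of_not_dvd hn f hd, mul_zero]

theorem ramify_injective {n : ℕ} (hn : 0 < n) {f g : MvPowerSeries (Fin 2) ℂ}
    (h : MvPowerSeries.subst ![varX ^ n, varY] f = MvPowerSeries.subst ![varX ^ n, varY] g) :
    f = g := by
  ext d
  rw [← coeff_ramify hn f d, h, coeff_ramify hn g d]

/-- A series invariant under `x ↦ ζ x`, with `ζ` a primitive `n`-th root of unity, is a series in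
`x^n` and `y`. -/
theorem exists_ramify_eq {n : ℕ} (hn : 0 < n) {ζ : ℂ} (hζ : IsPrimitiveRoot ζ n)
    {q : MvPowerSeries (Fin 2) ℂ} (hq : scaleX ζ q = q) :
    ∃ Q : MvPowerSeries (Fin 2) ℂ, MvPowerSeries.subst ![varX ^ n, varY] Q = q ∧
      (IsConvergentSeries q → IsConvergentSeries Q) := by
  set j : (Fin 2 →₀ ℕ) → (Fin 2 →₀ ℕ) := fun d =>
    Finsupp.single 0 (n * d 0) + Finsupp.single 1 (d 1) with hj
  set Q : MvPowerSeries (Fin 2) ℂ := fun d => MvPowerSeries.coeff (j d) q with hQ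
  have hQc : ∀ d, MvPowerSeries.coeff d Q = MvPowerSeries.coeff (j d) q := fun _ => rfl
  refine ⟨Q, ?_, fun hc => ?_⟩
  · ext d
    by_cases hd : n ∣ d 0
    · obtain ⟨t, ht⟩ := hd
      have h1 := coeff_ramify hn Q (Finsupp.single 0 t + Finsupp.single 1 (d 1))
      have h2 : j (Finsupp.single 0 t + Finsupp.single 1 (d 1)) = d := by
        ext s
        fin_cases s <;> simp [hj, ht]
      rw [hQc, h2] at h1
      rw [← h1]
      congr 1
      exact congrArg (MvPowerSeries.coeff (R := ℂ)) h2.symm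
    · rw [coeff_ramify_of_not_dvd hn Q hd]
      have h1 := congrArg (MvPowerSeries.coeff d) hq
      rw [coeff_scaleX] at h1
      by_contra hne
      exact hd ((hζ.pow_eq_one_iff_dvd _).1 (mul_right_cancel₀ (Ne.symm hne)
        (h1.trans (one_mul _).symm)))
  · refine hc.of_coeff_le j (fun d e h => ?_) n (fun d => ?_) (fun d => ?_)
    · have h0 := DFunLike.congr_fun h 0
      have h1 := DFunLike.congr_fun h 1
      simp [hj] at h0 h1
      ext s
      fin_cases s
      · exact h0.resolve_right hn.ne'
      · exact h1
    · rw [hj, map_add, Finsupp.degree_single, Finsupp.degree_single, Finsupp.degree_eq_sum d,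
        Fin.sum_univ_two]
      nlinarith
    · rw [hQc]
      exact le_mul_of_one_le_left (norm_nonneg _) (one_le_pow₀ one_le_two)

/-- The factors are divided out one at a time: at the root `-χ` the factor `y + ψ` takes the value
`ψ - χ ≠ 0`, so the remaining cofactor must vanish there. This needs the series to be distinct. -/
theorem exists_eq_prod_mul (S : Finset (PowerSeries ℂ))
    (hS : ∀ ψ ∈ S, IsConvergentSeries ψ ∧ PowerSeries.constantCoeff ψ = 0)
    {f : MvPowerSeries (Fin 2) ℂ} (hf : IsConvergentSeries f)
    (h : ∀ ψ ∈ S, MvPowerSeries.subst ![(PowerSeries.X : PowerSeries ℂ), -ψ] f =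
      (0 : PowerSeries ℂ)) :
    ∃ q, IsConvergentSeries q ∧ f = (∏ ψ ∈ S, (varY + inX ψ)) * q := by
  classical
  induction S using Finset.induction_on generalizing f with
  | empty => exact ⟨f, hf, by rw [Finset.prod_empty, one_mul]⟩
  | insert ψ S hψ ih =>
    obtain ⟨hψc, hψ0⟩ := hS ψ (Finset.mem_insert_self _ _)
    obtain ⟨q, hq, hqc⟩ := exists_eq_mul_of_psubst_eq_zero hψ0 (h ψ (Finset.mem_insert_self _ _))
    obtain ⟨q', hq'c, hq'⟩ := ih (fun χ hχ => hS χ (Finset.mem_insert_of_mem hχ)) (hqc hf hψc)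
      (fun χ hχ => by
        have hχ0 := constantCoeff_neg_eq_zero (hS χ (Finset.mem_insert_of_mem hχ)).2
        have h1 := h χ (Finset.mem_insert_of_mem hχ)
        rw [hq, MvPowerSeries.subst_mul (hasSubst_psubst hχ0), psubst_varY_add_inX hχ0] at h1
        refine (mul_eq_zero.1 h1).resolve_left fun h2 => hψ ?_
        rw [neg_add_eq_zero] at h2
        rwa [← h2])
    exact ⟨q', hq'c, by rw [Finset.prod_insert hψ, mul_assoc, ← hq', hq]⟩

theorem IsConvergentSeries.rescale {φ : PowerSeries ℂ} (hφ : IsConvergentSeries φ) (a : ℂ) :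
    IsConvergentSeries (PowerSeries.rescale a φ) := by
  rw [PowerSeries.rescale_eq_subst]
  refine hφ.psubst ((IsConvergentSeries.X ()).smul a) ?_
  rw [MvPowerSeries.constantCoeff_smul]
  exact (congrArg (a • ·) (MvPowerSeries.constantCoeff_X ())).trans (smul_zero a)

theorem constantCoeff_rescale_eq_zero {φ : PowerSeries ℂ} (hφ : PowerSeries.constantCoeff φ = 0)
    (a : ℂ) : PowerSeries.constantCoeff (PowerSeries.rescale a φ) = 0 := by
  rw [← PowerSeries.coeff_zero_eq_constantCoeff_apply, PowerSeries.coeff_rescale,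
    PowerSeries.coeff_zero_eq_constantCoeff_apply, hφ, mul_zero]

/-- The conjugates of an `n`-ramified series under `t ↦ ζ t`. -/
noncomputable def conjugates (n : ℕ) (φ : PowerSeries ℂ) : Finset (PowerSeries ℂ) :=
  open Classical in (Polynomial.nthRootsFinset n (1 : ℂ)).image fun a => PowerSeries.rescale a φ

theorem mem_conjugates {n : ℕ} (hn : 0 < n) {φ ψ : PowerSeries ℂ} :
    ψ ∈ conjugates n φ ↔ ∃ a : ℂ, a ^ n = 1 ∧ PowerSeries.rescale a φ = ψ := by
  classical
  rw [conjugates, Finset.mem_image]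
  simp only [Polynomial.mem_nthRootsFinset hn]

/-- Rescaling by `ζ` permutes the conjugates, with inverse rescaling by `ζ⁻¹`. -/
theorem scaleX_prod_conjugates {n : ℕ} (hn : 0 < n) {ζ : ℂ} (hζ : ζ ^ n = 1) (φ : PowerSeries ℂ) :
    scaleX ζ (∏ ψ ∈ conjugates n φ, (varY + inX ψ)) = ∏ ψ ∈ conjugates n φ, (varY + inX ψ) := by
  have hζ0 : ζ ≠ 0 := by
    rintro rfl
    rw [zero_pow hn.ne'] at hζ
    exact zero_ne_one hζ
  rw [map_prod]
  have hmem : ∀ z : ℂ, z ^ n = 1 → ∀ ψ ∈ conjugates n φ,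
      PowerSeries.rescale z ψ ∈ conjugates n φ := by
    intro z hz ψ hψ
    obtain ⟨a, ha, rfl⟩ := (mem_conjugates hn).1 hψ
    rw [PowerSeries.rescale_rescale]
    exact (mem_conjugates hn).2 ⟨a * z, by rw [mul_pow, ha, hz, one_mul], rfl⟩
  refine Finset.prod_nbij' (fun ψ => PowerSeries.rescale ζ ψ) (fun ψ => PowerSeries.rescale ζ⁻¹ ψ)
    (hmem ζ hζ) (hmem ζ⁻¹ (by rw [inv_pow, hζ, inv_one])) ?_ ?_ ?_
  · intro ψ _
    rw [PowerSeries.rescale_rescale, mul_inv_cancel₀ hζ0, PowerSeries.rescale_one, RingHom.id_apply]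
  · intro ψ _
    rw [PowerSeries.rescale_rescale, inv_mul_cancel₀ hζ0, PowerSeries.rescale_one, RingHom.id_apply]
  · intro ψ _
    exact scaleX_varY_add_inX ζ ψ

/-- An irreducible `p` with Puiseux factor `y + φ(x^{1/n})` is, up to a unit, the product of the
distinct conjugates of this factor. -/
theorem exists_ramify_eq_prod_conjugates {p : ConvXY} (hp : Irreducible p) {n : ℕ}
    {φ : PowerSeries ℂ} (h : IsPuiseuxFactor p n φ) :
    ∃ F Q : MvPowerSeries (Fin 2) ℂ, IsUnit Q ∧ (p : MvPowerSeries (Fin 2) ℂ) = F * Q ∧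
      MvPowerSeries.subst ![varX ^ n, varY] F = ∏ ψ ∈ conjugates n φ, (varY + inX ψ) := by
  obtain ⟨hn, hφ, hφ0, q₀, hq₀⟩ := h
  set f := MvPowerSeries.subst ![varX ^ n, varY] (p : MvPowerSeries (Fin 2) ℂ) with hf
  have hfc : IsConvergentSeries f := IsConvergentSeries.ramify p.2 hn
  have hconj : ∀ ψ ∈ conjugates n φ,
      IsConvergentSeries ψ ∧ PowerSeries.constantCoeff ψ = 0 := by
    intro ψ hψ
    obtain ⟨a, _, rfl⟩ := (mem_conjugates hn).1 hψ
    exact ⟨hφ.rescale a, constantCoeff_rescale_eq_zero hφ0 a⟩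
  set F₀ := ∏ ψ ∈ conjugates n φ, (varY + inX ψ) with hF₀
  have hF₀c : IsConvergentSeries F₀ := (convergentSeries (Fin 2)).prod_mem fun ψ hψ =>
    (IsConvergentSeries.X 1).add (isConvergentSeries_inX (hconj ψ hψ).1)
  -- Since `p(t^n, y)` is invariant under `t ↦ at`, every conjugate of a factor is again a factor.
  obtain ⟨q, hqc, hq⟩ := exists_eq_prod_mul (conjugates n φ) hconj hfc (fun ψ hψ => by
    obtain ⟨a, ha, rfl⟩ := (mem_conjugates hn).1 hψ
    refine psubst_neg_eq_zero_of_dvd (constantCoeff_rescale_eq_zero hφ0 a) ?_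
    rw [← scaleX_varY_add_inX, hf, ← scaleX_ramify hn ha]
    exact map_dvd _ ⟨_, hq₀⟩)
  have hf0 : f ≠ 0 := by
    intro h0
    apply hp.ne_zero
    apply Subtype.ext
    refine ramify_injective hn (f := (p : MvPowerSeries (Fin 2) ℂ)) (g := 0) ?_
    rw [← hf, h0, ← MvPowerSeries.coe_substAlgHom (hasSubst_ramify hn), map_zero]
  have hζ := Complex.isPrimitiveRoot_exp n hn.ne'
  have hF₀ζ := scaleX_prod_conjugates hn hζ.pow_eq_one φ
  obtain ⟨F, hF, hFc⟩ := exists_ramify_eq hn hζ hF₀ζ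
  -- The cofactor is invariant too, because both `f` and `F₀` are and `F₀` can be cancelled.
  obtain ⟨Q, hQ, hQc⟩ := exists_ramify_eq hn hζ (q := q) (by
    have h1 := congrArg (scaleX (Complex.exp (2 * Real.pi * Complex.I / n))) hq
    rw [hf, scaleX_ramify hn hζ.pow_eq_one, ← hf, map_mul, hF₀ζ] at h1
    exact (mul_left_cancel₀ (left_ne_zero_of_mul (hq ▸ hf0)) (hq.symm.trans h1)).symm)
  have hpFQ : (p : MvPowerSeries (Fin 2) ℂ) = F * Q := by
    apply ramify_injective hn
    rw [MvPowerSeries.subst_mul (hasSubst_ramify hn), hF, hQ, ← hf, hq]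
  refine ⟨F, Q, ?_, hpFQ, hF⟩
  have hval : ∀ g : ConvXY, IsUnit g → IsUnit (g : MvPowerSeries (Fin 2) ℂ) := fun g hg =>
    hg.map (convergentSeries (Fin 2)).val
  -- The product `F` vanishes at the origin, through the conjugate with `a = 1`, so the unit must be
  -- `Q`.
  rcases hp.isUnit_or_isUnit (a := ⟨F, hFc hF₀c⟩) (b := ⟨Q, hQc hqc⟩) (Subtype.ext hpFQ) with hu | hu
  · exfalso
    have h1 := (hval _ hu).map MvPowerSeries.constantCoeff
    have h2 : MvPowerSeries.constantCoeff F = 0 := by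
      rw [← constantCoeff_subst_pair (constantCoeff_X_pow (0 : Fin 2) hn)
        (MvPowerSeries.constantCoeff_X 1), hF, map_prod]
      refine Finset.prod_eq_zero ((mem_conjugates hn).2 ⟨1, one_pow n, rfl⟩) ?_
      exact constantCoeff_varY_add_inX (constantCoeff_rescale_eq_zero hφ0 1)
    rw [h2] at h1
    exact not_isUnit_zero h1
  · exact hval _ hu

/-! ### Statement (1): invariance of the leading part -/

/-- The series `h(t^n)` is fixed by `t ↦ at`, and rescaling preserves divisibility by powers of `t`.
-/
theorem HasLeadingPart.rescale {h : Polynomial ℂ} {m n : ℕ} {φ : PowerSeries ℂ}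
    (H : HasLeadingPart h m n φ) {a : ℂ} (ha : a ^ n = 1) :
    HasLeadingPart h m n (PowerSeries.rescale a φ) := by
  have h1 : PowerSeries.rescale a (Polynomial.aeval ((PowerSeries.X : PowerSeries ℂ) ^ n) h) =
      Polynomial.aeval ((PowerSeries.X : PowerSeries ℂ) ^ n) h := by
    have h2 : ∀ f, PowerSeries.rescale a f = PowerSeries.rescaleAlgHom a f := fun f => by
      rw [← PowerSeries.coe_rescaleAlgHom]
      rfl
    rw [h2, ← Polynomial.aeval_algHom_apply, map_pow, ← h2, PowerSeries.rescale_X, mul_pow,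
      ← map_pow, ha, map_one, one_mul]
  unfold HasLeadingPart at H ⊢
  rw [← h1, ← map_sub]
  rw [PowerSeries.X_pow_dvd_iff] at H ⊢
  intro k hk
  rw [PowerSeries.coeff_rescale, H k hk, mul_zero]

/-- The hypothesis says that `φ(x^{1/n})` and `φ'(x^{1/n'})` are the same fractional series, written
over the common ramification `n n'`; the leading part depends only on that series. -/
theorem HasLeadingPart.of_subst_eq {h : Polynomial ℂ} {m n n' : ℕ} {φ φ' : PowerSeries ℂ}
    (hn : 0 < n) (hn' : 0 < n') (H : HasLeadingPart h m n φ)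
    (e : PowerSeries.subst ((PowerSeries.X : PowerSeries ℂ) ^ n) φ' =
      (PowerSeries.subst ((PowerSeries.X : PowerSeries ℂ) ^ n') φ : PowerSeries ℂ)) :
    HasLeadingPart h m n' φ' := by
  have key : ∀ {k l : ℕ} (_ : 0 < k) (χ : PowerSeries ℂ),
      PowerSeries.subst ((PowerSeries.X : PowerSeries ℂ) ^ k)
        (χ - Polynomial.aeval ((PowerSeries.X : PowerSeries ℂ) ^ l) h) =
      PowerSeries.subst ((PowerSeries.X : PowerSeries ℂ) ^ k) χ -
        Polynomial.aeval ((PowerSeries.X : PowerSeries ℂ) ^ (k * l)) h := by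
    intro k l hk χ
    have hs : PowerSeries.HasSubst ((PowerSeries.X : PowerSeries ℂ) ^ k) :=
      PowerSeries.HasSubst.X_pow hk.ne'
    rw [PowerSeries.subst_sub hs]
    congr 1
    have h1 := Polynomial.aeval_algHom_apply (PowerSeries.substAlgHom hs)
      ((PowerSeries.X : PowerSeries ℂ) ^ l) h
    rw [map_pow, PowerSeries.substAlgHom_X, ← pow_mul, PowerSeries.coe_substAlgHom] at h1
    exact h1.symm
  have h1 : (PowerSeries.subst ((PowerSeries.X : PowerSeries ℂ) ^ n)
      (φ' - Polynomial.aeval ((PowerSeries.X : PowerSeries ℂ) ^ n') h) : PowerSeries ℂ) =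
      PowerSeries.subst ((PowerSeries.X : PowerSeries ℂ) ^ n')
      (φ - Polynomial.aeval ((PowerSeries.X : PowerSeries ℂ) ^ n) h) := by
    rw [key hn, key hn', e, mul_comm n n']
  unfold HasLeadingPart at H ⊢
  rw [PowerSeries.X_pow_dvd_iff] at H ⊢
  intro k hk
  have h2 := congrArg (PowerSeries.coeff (n * k)) h1
  rw [PowerSeries.coeff_subst_X_pow hn.ne', if_pos (dvd_mul_right _ _),
    Nat.mul_div_cancel_left _ hn, PowerSeries.coeff_subst_X_pow hn'.ne'] at h2
  refine h2.trans ?_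
  split_ifs with hd
  · obtain ⟨t, ht⟩ := hd
    rw [ht, Nat.mul_div_cancel_left _ hn', H t, map_zero]
    have h3 : n * k ≤ n * (n' * m) := Nat.mul_le_mul_left n (by omega)
    have h4 : n' * t ≤ n' * (n * m) := by rw [← ht]; convert h3 using 1; ring
    have := Nat.le_of_mul_le_mul_left h4 hn'
    omega
  · rfl

/-- The second factor gives a root of `F`, since `Q` is a unit. Over the common ramification `n n'`
the series `F` splits into conjugates of the first factor, and one of these must vanish at the root.
-/
theorem HasLeadingPart.of_irreducible {p : ConvXY} (hp : Irreducible p) {h : Polynomial ℂ}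
    {m n n' : ℕ} {φ φ' : PowerSeries ℂ} (hφ : IsPuiseuxFactor p n φ)
    (H : HasLeadingPart h m n φ) (hφ' : IsPuiseuxFactor p n' φ') : HasLeadingPart h m n' φ' := by
  obtain ⟨F, Q, hQ, hpFQ, hF⟩ := exists_ramify_eq_prod_conjugates hp hφ
  have hn := hφ.pos
  obtain ⟨hn', -, hφ'0, hroot⟩ := isPuiseuxFactor_iff.1 hφ'
  have hφ'n := constantCoeff_neg_eq_zero hφ'0
  have hs : MvPowerSeries.HasSubst ![(PowerSeries.X : PowerSeries ℂ) ^ n', -φ'] :=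
    hasSubst_pair (constantCoeff_pX_pow hn') hφ'n
  have hQ' : IsUnit (MvPowerSeries.subst ![(PowerSeries.X : PowerSeries ℂ) ^ n', -φ'] Q) := by
    rw [← MvPowerSeries.coe_substAlgHom hs]
    exact hQ.map _
  rw [hpFQ, MvPowerSeries.subst_mul hs] at hroot
  have hFroot := (mul_eq_zero.1 hroot).resolve_right hQ'.ne_zero
  have hX : MvPowerSeries.constantCoeff ((PowerSeries.X : PowerSeries ℂ) ^ n) = 0 :=
    constantCoeff_pX_pow hn
  have hsX : PowerSeries.HasSubst ((PowerSeries.X : PowerSeries ℂ) ^ n) :=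
    PowerSeries.HasSubst.X_pow hn.ne'
  set χ : PowerSeries ℂ := PowerSeries.subst ((PowerSeries.X : PowerSeries ℂ) ^ n) φ' with hχ
  have hχ0 : PowerSeries.constantCoeff (-χ) = 0 :=
    constantCoeff_neg_eq_zero ((constantCoeff_psubst hX φ').trans hφ'0)
  have hsχ : MvPowerSeries.HasSubst ![(PowerSeries.X : PowerSeries ℂ) ^ n', -χ] :=
    hasSubst_pair (constantCoeff_pX_pow hn') hχ0
  have h1 : MvPowerSeries.subst ![(PowerSeries.X : PowerSeries ℂ) ^ n', -χ]
      (∏ ψ ∈ conjugates n φ, (varY + inX ψ)) = (0 : PowerSeries ℂ) := by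
    rw [← hF, subst_pair_ramify hn hsχ]
    have h2 := congrArg (PowerSeries.subst ((PowerSeries.X : PowerSeries ℂ) ^ n)) hFroot
    unfold PowerSeries.subst at h2
    rw [subst_subst_pair hs hsX.const] at h2
    have h3 : MvPowerSeries.subst (fun _ : Unit => (PowerSeries.X : PowerSeries ℂ) ^ n)
        ((PowerSeries.X : PowerSeries ℂ) ^ n') = ((PowerSeries.X : PowerSeries ℂ) ^ n') ^ n := by
      refine (MvPowerSeries.subst_pow hsX.const _ _).trans ?_
      rw [← pow_mul, mul_comm n' n, pow_mul]
      exact congrArg (· ^ n') (MvPowerSeries.subst_X hsX.const ())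
    rw [h3] at h2
    refine Eq.trans ?_ (h2.trans ?_)
    · congr 3
      exact (psubst_neg hX φ').symm
    · rw [← MvPowerSeries.coe_substAlgHom hsX.const, map_zero]
  rw [← MvPowerSeries.coe_substAlgHom hsχ, map_prod, Finset.prod_eq_zero_iff] at h1
  obtain ⟨ψ, hψ, h2⟩ := h1
  obtain ⟨a, ha, rfl⟩ := (mem_conjugates hn).1 hψ
  rw [MvPowerSeries.coe_substAlgHom hsχ, subst_pair_varY_add_inX hsχ] at h2
  exact (H.rescale ha).of_subst_eq hn hn' (neg_add_eq_zero.1 h2)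

/-! ### Statement (2): the leading part in the coordinate `y + h(x)` -/

section leadingPart

variable {p : ConvXY} {h : Polynomial ℂ} {m : ℕ}

theorem constantCoeff_coe_eq_zero (hh0 : h.eval 0 = 0) :
    PowerSeries.constantCoeff (h : PowerSeries ℂ) = 0 := by
  rw [Polynomial.constantCoeff_coe, Polynomial.coeff_zero_eq_eval_zero, hh0]

theorem psubst_X_pow_coe {n : ℕ} (hn : 0 < n) (h : Polynomial ℂ) :
    PowerSeries.subst ((PowerSeries.X : PowerSeries ℂ) ^ n) (h : PowerSeries ℂ) =
      Polynomial.aeval ((PowerSeries.X : PowerSeries ℂ) ^ n) h :=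
  PowerSeries.subst_coe (PowerSeries.HasSubst.X_pow hn.ne') h

theorem constantCoeff_aeval_X_pow (hh0 : h.eval 0 = 0) {n : ℕ} (hn : 0 < n) :
    PowerSeries.constantCoeff (Polynomial.aeval ((PowerSeries.X : PowerSeries ℂ) ^ n) h) = 0 :=
  (constantCoeff_aeval (constantCoeff_pX_pow hn) h).trans hh0

/-- In the coordinate `y + h(x)`, the leading part of the Puiseux factors becomes their order. -/
theorem hasLeadingPart_iff_puiseuxRootsOrderGT (hh0 : h.eval 0 = 0) :
    (∀ (n : ℕ) (φ : PowerSeries ℂ), IsPuiseuxFactor p n φ → HasLeadingPart h m n φ) ↔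
      PuiseuxRootsOrderGT (MvPowerSeries.subst ![varX, varY + inX (-(h : PowerSeries ℂ))]
        (p : MvPowerSeries (Fin 2) ℂ)) m := by
  have hneg := constantCoeff_neg_eq_zero (constantCoeff_coe_eq_zero hh0)
  have key : ∀ {n : ℕ} (hn : 0 < n) {ψ : PowerSeries ℂ} (_ : PowerSeries.constantCoeff ψ = 0),
      MvPowerSeries.subst ![(PowerSeries.X : PowerSeries ℂ) ^ n, ψ]
        (MvPowerSeries.subst ![varX, varY + inX (-(h : PowerSeries ℂ))]
          (p : MvPowerSeries (Fin 2) ℂ)) =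
      MvPowerSeries.subst ![(PowerSeries.X : PowerSeries ℂ) ^ n,
        -(Polynomial.aeval ((PowerSeries.X : PowerSeries ℂ) ^ n) h - ψ)]
          (p : MvPowerSeries (Fin 2) ℂ) := by
    intro n hn ψ hψ
    rw [subst_subst_shift hneg (constantCoeff_pX_pow hn) hψ, psubst_neg (constantCoeff_pX_pow hn),
      psubst_X_pow_coe hn]
    congr 3
    change ψ + -_ = _
    ring
  constructor
  · intro H n ψ hn hψ hψ0 hroot
    rw [key hn hψ0] at hroot
    have h1 := H n _ (isPuiseuxFactor_iff.2 ⟨hn,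
      ((isConvergentSeries_pX_pow n).aeval h).sub hψ, by
        rw [map_sub, constantCoeff_aeval_X_pow hh0 hn, hψ0, sub_zero], hroot⟩)
    unfold HasLeadingPart at h1
    rwa [sub_sub_cancel_left, dvd_neg] at h1
  · intro H n φ hφ
    obtain ⟨hn, hφc, hφ0, hroot⟩ := isPuiseuxFactor_iff.1 hφ
    have h0 : PowerSeries.constantCoeff
        (Polynomial.aeval ((PowerSeries.X : PowerSeries ℂ) ^ n) h - φ) = 0 := by
      rw [map_sub, constantCoeff_aeval_X_pow hh0 hn, hφ0, sub_zero]
    have h1 := H n (Polynomial.aeval ((PowerSeries.X : PowerSeries ℂ) ^ n) h - φ) hn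
      (((isConvergentSeries_pX_pow n).aeval h).sub hφc) h0 (by
        rw [key hn h0, sub_sub_cancel, hroot])
    unfold HasLeadingPart
    rwa [← neg_sub, dvd_neg]

theorem HasLowestYPower.hasYOrder {r : ℕ} (hpr : HasLowestYPower p r) :
    HasYOrder (p : MvPowerSeries (Fin 2) ℂ) r :=
  ⟨by rw [hpr.1]; exact one_ne_zero, hpr.2⟩

/-- The series `a` is the sheared `p` minus `y^r`. Off the exponent of `y^r`, the inequality `i +
j/m > r` is automatic for `i ≥ r`, so only the Newton polygon condition for `i < r` remains. -/
theorem newtonPolygonAbove_iff_exists_expansion {r : ℕ} (hpr : HasLowestYPower p r)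
    (hm : 0 < m) (hh0 : h.eval 0 = 0) :
    NewtonPolygonAbove (MvPowerSeries.subst ![varX, varY + inX (-(h : PowerSeries ℂ))]
        (p : MvPowerSeries (Fin 2) ℂ)) r m ↔
      ∃ a : MvPowerSeries (Fin 2) ℂ, IsConvergentSeries a ∧
        (∀ d : Fin 2 →₀ ℕ, MvPowerSeries.coeff d a ≠ 0 → (r : ℚ) < (d 1 : ℚ) + (d 0 : ℚ) / m) ∧
        (p : MvPowerSeries (Fin 2) ℂ) =
          (varY + polyInX h) ^ r + MvPowerSeries.subst ![varX, varY + polyInX h] a := by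
  classical
  have hc := constantCoeff_coe_eq_zero hh0
  have hneg := constantCoeff_neg_eq_zero hc
  have hs : MvPowerSeries.HasSubst ![varX, varY + inX (h : PowerSeries ℂ)] :=
    hasSubst_pair (MvPowerSeries.constantCoeff_X 0) (constantCoeff_varY_add_inX hc)
  have hcoe : IsConvergentSeries (h : PowerSeries ℂ) := by
    have := (isConvergentSeries_pX_pow 1).aeval h
    rwa [← psubst_X_pow_coe one_pos, pow_one, PowerSeries.X_subst] at this
  have hmQ : (0 : ℚ) < m := by exact_mod_cast hm
  have hexp : ∀ a : MvPowerSeries (Fin 2) ℂ,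
      MvPowerSeries.subst ![varX, varY + inX (h : PowerSeries ℂ)] (varY ^ r + a) =
        (varY + polyInX h) ^ r + MvPowerSeries.subst ![varX, varY + polyInX h] a := by
    intro a
    rw [MvPowerSeries.subst_add hs, MvPowerSeries.subst_pow hs, subst_pair_varY hs, inX_coe]
  rw [← inX_coe] at hexp ⊢
  set P := MvPowerSeries.subst ![varX, varY + inX (-(h : PowerSeries ℂ))]
    (p : MvPowerSeries (Fin 2) ℂ) with hP
  have hpP : MvPowerSeries.subst ![varX, varY + inX (h : PowerSeries ℂ)] P = p := by
    have := subst_shift_neg hneg (p : MvPowerSeries (Fin 2) ℂ)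
    rwa [neg_neg] at this
  constructor
  · intro H
    refine ⟨P - varY ^ r, ?_, fun d hd => ?_, ?_⟩
    · exact (IsConvergentSeries.subst_shift p.2 hcoe.neg hneg).sub ((IsConvergentSeries.X 1).pow r)
    · have hlt : m * r < m * d 1 + d 0 := by
        rw [map_sub, MvPowerSeries.coeff_X_pow] at hd
        split_ifs at hd with hd1
        · rw [hd1, hP, coeff_single_one_subst_shift hneg, hpr.1, sub_self] at hd
          exact absurd rfl hd
        · rw [sub_zero] at hd
          rcases lt_trichotomy (d 1) r with hlt | heq | hgt
          · have h2 := H d hlt hd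
            have h3 : m * r = m * (r - d 1) + m * d 1 := by
              rw [← mul_add, Nat.sub_add_cancel hlt.le]
            omega
          · have : 0 < d 0 := by
              by_contra h0
              apply hd1
              ext s
              fin_cases s
              · simpa using h0
              · simp [heq]
            rw [heq]
            omega
          · have := Nat.mul_lt_mul_of_pos_left hgt hm
            omega
      have hltQ : (m : ℚ) * r < m * d 1 + d 0 := by exact_mod_cast hlt
      have h4 : (d 1 : ℚ) + (d 0 : ℚ) / m = (m * d 1 + d 0) / m := by field_simp
      rw [h4, lt_div_iff₀ hmQ]
      linarith
    · rw [← hexp, add_sub_cancel, hpP]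
  · rintro ⟨a, -, ha, hpa⟩ d hd hne
    have hPa : P = varY ^ r + a := by
      rw [← hexp] at hpa
      rw [hP, hpa, subst_shift_neg hc]
    rw [hPa, map_add, MvPowerSeries.coeff_X_pow, if_neg (by
      rintro rfl
      simp at hd), zero_add] at hne
    have h1 := ha d hne
    have h4 : (d 1 : ℚ) + (d 0 : ℚ) / m = (m * d 1 + d 0) / m := by field_simp
    rw [h4, lt_div_iff₀ hmQ] at h1
    have h2 : m * r < m * d 1 + d 0 := by
      have : (m : ℚ) * r < m * d 1 + d 0 := by linarith
      exact_mod_cast this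
    have h3 : m * r = m * (r - d 1) + m * d 1 := by rw [← mul_add, Nat.sub_add_cancel hd.le]
    omega

end leadingPart

/-! ### Statements (3) and (4): the normalized derivative -/

section normalizedDerivative

variable {p : ConvXY} {k : ℕ}

theorem normalizedYDeriv_succ (p : ConvXY) (k : ℕ) : normalizedYDeriv p (k + 1) =
    (((k + 1).factorial : ℂ)⁻¹) •
      (fun f : MvPowerSeries (Fin 2) ℂ => MvPowerSeries.pderiv ℂ 1 f)^[k]
        (p : MvPowerSeries (Fin 2) ℂ) := rfl

theorem isConvergentSeries_normalizedYDeriv (p : ConvXY) (r : ℕ) :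
    IsConvergentSeries (normalizedYDeriv p r) :=
  (IsConvergentSeries.iterate_pderiv p.2 _).smul _

theorem HasLowestYPower.constantCoeff_normalizedYDeriv (hpr : HasLowestYPower p (k + 1)) :
    MvPowerSeries.constantCoeff (normalizedYDeriv p (k + 1)) = 0 := by
  rw [normalizedYDeriv_succ, MvPowerSeries.constantCoeff_smul,
    hpr.hasYOrder.constantCoeff_iterate_pderiv, smul_zero]

theorem HasLowestYPower.coeff_normalizedYDeriv (hpr : HasLowestYPower p (k + 1)) :
    MvPowerSeries.coeff (Finsupp.single 1 1) (normalizedYDeriv p (k + 1)) = 1 := by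
  rw [normalizedYDeriv_succ, MvPowerSeries.coeff_smul, coeff_single_one_one_iterate_pderiv, hpr.1,
    mul_one]
  exact inv_mul_cancel₀ (by exact_mod_cast Nat.factorial_ne_zero _)

theorem constantCoeff_pderiv (f : MvPowerSeries (Fin 2) ℂ) :
    MvPowerSeries.constantCoeff (MvPowerSeries.pderiv ℂ 1 f) =
      MvPowerSeries.coeff (Finsupp.single 1 1) f := by
  rw [← MvPowerSeries.coeff_zero_eq_constantCoeff_apply, MvPowerSeries.coeff_pderiv, zero_add]
  simp

theorem subst_shift_normalizedYDeriv {φ : PowerSeries ℂ} (hφ : PowerSeries.constantCoeff φ = 0) :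
    MvPowerSeries.subst ![varX, varY + inX φ] (normalizedYDeriv p (k + 1)) =
      (((k + 1).factorial : ℂ)⁻¹) •
        (fun f : MvPowerSeries (Fin 2) ℂ => MvPowerSeries.pderiv ℂ 1 f)^[k]
          (MvPowerSeries.subst ![varX, varY + inX φ] (p : MvPowerSeries (Fin 2) ℂ)) := by
  rw [normalizedYDeriv_succ, MvPowerSeries.subst_smul (hasSubst_pair
    (MvPowerSeries.constantCoeff_X 0) (constantCoeff_varY_add_inX hφ)),
    iterate_pderiv_subst_shift hφ]

/-- The root of the normalized derivative lies above the Newton polygon as well. -/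
theorem NewtonPolygonAbove.X_pow_dvd_root {φ g : PowerSeries ℂ} {m : ℕ}
    (hpr : HasLowestYPower p (k + 1)) (hφ : PowerSeries.constantCoeff φ = 0)
    (hg : PowerSeries.constantCoeff g = 0)
    (H : NewtonPolygonAbove (MvPowerSeries.subst ![varX, varY + inX φ]
      (p : MvPowerSeries (Fin 2) ℂ)) (k + 1) m)
    (hroot : MvPowerSeries.subst ![(PowerSeries.X : PowerSeries ℂ), g]
      (normalizedYDeriv p (k + 1)) = (0 : PowerSeries ℂ)) :
    PowerSeries.X ^ (m + 1) ∣ g - φ := by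
  set N := MvPowerSeries.subst ![varX, varY + inX φ] (normalizedYDeriv p (k + 1)) with hN
  have hgφ : PowerSeries.constantCoeff (g - φ) = 0 := by rw [map_sub, hg, hφ, sub_zero]
  obtain ⟨w, hw, e⟩ := exists_psubst_sub_eq_mul hgφ (map_zero _) N
  have h1 : MvPowerSeries.subst ![(PowerSeries.X : PowerSeries ℂ), g - φ] N =
      (0 : PowerSeries ℂ) := by
    rw [hN, psubst_X_subst_shift hφ hgφ, sub_add_cancel, hroot]
  have hwu : IsUnit w := by
    rw [PowerSeries.isUnit_iff_constantCoeff, hw, hN, coeff_single_one_subst_shift hφ,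
      hpr.coeff_normalizedYDeriv]
    exact isUnit_one
  -- On `y = 0` the derivative retains, up to constants, the coefficients of `x^j y^k`; one step
  -- below `y^(k+1)` the polygon forces `j > m`.
  have h2 : PowerSeries.X ^ (m + 1) ∣
      (MvPowerSeries.subst ![(PowerSeries.X : PowerSeries ℂ), 0] N : PowerSeries ℂ) := by
    rw [PowerSeries.X_pow_dvd_iff]
    intro j hj
    rw [psubst_X_zero_coeff, hN, subst_shift_normalizedYDeriv hφ, MvPowerSeries.coeff_smul,
      coeff_iterate_pderiv]
    have h3 : MvPowerSeries.coeff (Finsupp.single 0 j + Finsupp.single 1 k)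
        (MvPowerSeries.subst ![varX, varY + inX φ] (p : MvPowerSeries (Fin 2) ℂ)) = 0 := by
      by_contra hne
      have h4 := H _ (by simp) hne
      simp at h4
      omega
    rw [h3, mul_zero, mul_zero]
  rw [h1, zero_sub, sub_zero] at e
  rwa [← dvd_neg, e, hwu.dvd_mul_right] at h2

theorem IsWeierstrassPolynomial.coeff_eq (hW : IsWeierstrassPolynomial p (k + 1))
    {d : Fin 2 →₀ ℕ} (hd : k + 1 ≤ d 1) :
    MvPowerSeries.coeff d (p : MvPowerSeries (Fin 2) ℂ) =
      MvPowerSeries.coeff d (varY ^ (k + 1)) := by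
  classical
  obtain ⟨a, -, e⟩ := hW
  rw [e, map_add, add_eq_left, map_sum]
  refine Finset.sum_eq_zero fun i _ => ?_
  by_contra hne
  obtain ⟨b, c, hbc, hb, hc⟩ := exists_add_eq_of_coeff_mul_ne_zero hne
  rw [coeff_inX, ite_ne_right_iff] at hb
  rw [MvPowerSeries.coeff_X_pow, ite_ne_right_iff] at hc
  have h1 := DFunLike.congr_fun hbc 1
  rw [hc.1, Finsupp.add_apply, hb.1, Finsupp.single_eq_same] at h1
  have := i.2
  omega

/-- Coefficients of positive `y`-degree in the derivative come from `y`-degree at least `k + 1` in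
`p`, where only `y^(k+1)` occurs; the rest is a series in `x`, found by setting `y = 0`. -/
theorem IsWeierstrassPolynomial.normalizedYDeriv_eq (hpr : HasLowestYPower p (k + 1))
    (hW : IsWeierstrassPolynomial p (k + 1)) :
    ∃ s : PowerSeries ℂ, normalizedYDeriv p (k + 1) = varY + inX s := by
  classical
  refine ⟨MvPowerSeries.subst ![(PowerSeries.X : PowerSeries ℂ), 0] (normalizedYDeriv p (k + 1)),
    ?_⟩
  ext d
  rw [map_add, coeff_inX]
  by_cases h1 : d 1 = 0
  · have hd : d = Finsupp.single 0 (d 0) := by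
      ext s
      fin_cases s <;> simp [h1]
    rw [if_pos h1, psubst_X_zero_coeff, ← hd, MvPowerSeries.coeff_X, if_neg, zero_add]
    intro h
    rw [h, Finsupp.single_eq_same] at h1
    exact one_ne_zero h1
  · rw [if_neg h1, add_zero, MvPowerSeries.coeff_X]
    split_ifs with hd
    · rw [hd, hpr.coeff_normalizedYDeriv]
    · rw [normalizedYDeriv_succ, MvPowerSeries.coeff_smul, coeff_iterate_pderiv,
        hW.coeff_eq (by simp; omega), MvPowerSeries.coeff_X_pow, if_neg, mul_zero, mul_zero]
      intro h
      apply hd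
      rw [add_comm k 1, Finsupp.single_add] at h
      exact add_right_cancel h

end normalizedDerivative

/-! ### The theorem -/

theorem mainTheorem5 (p : ConvXY) (r : ℕ) (h : Polynomial ℂ) (m : ℕ)
    (hp0 : MvPowerSeries.constantCoeff (p : MvPowerSeries (Fin 2) ℂ) = 0)
    (hpr : HasLowestYPower p r)
    (hm : h.degree = (m : WithBot ℕ)) (hh0 : h.eval 0 = 0) :
    -- (1) if `p` is irreducible, one Puiseux factor of the given form forces all of them
    (Irreducible p →
      (∃ (n : ℕ) (φ : PowerSeries ℂ), IsPuiseuxFactor p n φ ∧ HasLeadingPart h m n φ) →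
      ∀ (n : ℕ) (φ : PowerSeries ℂ), IsPuiseuxFactor p n φ → HasLeadingPart h m n φ) ∧
    -- (2) all Puiseux factors have the form iff
    -- `p = (y + h(x))^r + ∑_{i + j/m > r} a_{ij} (y + h(x))^i x^j`
    ((∀ (n : ℕ) (φ : PowerSeries ℂ), IsPuiseuxFactor p n φ → HasLeadingPart h m n φ) ↔
      ∃ a : MvPowerSeries (Fin 2) ℂ, IsConvergentSeries a ∧
        (∀ d : Fin 2 →₀ ℕ, MvPowerSeries.coeff d a ≠ 0 → (r : ℚ) < (d 1 : ℚ) + (d 0 : ℚ) / m) ∧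
        (p : MvPowerSeries (Fin 2) ℂ) =
          (varY + polyInX h) ^ r + MvPowerSeries.subst ![varX, varY + polyInX h] a) ∧
    -- (3) the implicit function theorem applies to the normalized derivative at the origin; its
    -- solution `y = g(x)` is `-h(x) - (higher terms)` if all Puiseux factors have the form
    (MvPowerSeries.constantCoeff (normalizedYDeriv p r) = 0 ∧
      MvPowerSeries.constantCoeff (MvPowerSeries.pderiv ℂ 1 (normalizedYDeriv p r)) ≠ 0 ∧
      ∃ g : PowerSeries ℂ,
        (IsConvergentSeries g ∧ PowerSeries.constantCoeff g = 0 ∧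
          MvPowerSeries.subst ![(PowerSeries.X : PowerSeries ℂ), g] (normalizedYDeriv p r)
            = (0 : PowerSeries ℂ)) ∧
        (∀ g' : PowerSeries ℂ, PowerSeries.constantCoeff g' = 0 →
          MvPowerSeries.subst ![(PowerSeries.X : PowerSeries ℂ), g'] (normalizedYDeriv p r)
            = (0 : PowerSeries ℂ) → g' = g) ∧
        ((∀ (n : ℕ) (φ : PowerSeries ℂ), IsPuiseuxFactor p n φ → HasLeadingPart h m n φ) →
          ∃ ψ : PowerSeries ℂ, IsConvergentSeries ψ ∧
            (PowerSeries.X : PowerSeries ℂ) ^ (m + 1) ∣ ψ ∧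
            g = -(h : PowerSeries ℂ) - ψ)) ∧
    -- (4) for a Weierstrass polynomial the normalized derivative is `y + h(x) + (higher terms)`
    (IsWeierstrassPolynomial p r →
      (∀ (n : ℕ) (φ : PowerSeries ℂ), IsPuiseuxFactor p n φ → HasLeadingPart h m n φ) →
      ∃ ψ : PowerSeries ℂ, IsConvergentSeries ψ ∧
        (PowerSeries.X : PowerSeries ℂ) ^ (m + 1) ∣ ψ ∧
        normalizedYDeriv p r = varY + polyInX h + inX ψ) := by
  have hr : ∃ k, r = k + 1 := by
    rcases r with _ | k
    · have h1 := hpr.1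
      rw [Finsupp.single_zero, MvPowerSeries.coeff_zero_eq_constantCoeff_apply, hp0] at h1
      exact absurd h1 zero_ne_one
    · exact ⟨k, rfl⟩
  obtain ⟨k, rfl⟩ := hr
  -- Degree zero would make `h` a constant vanishing at `0`, hence the zero polynomial, whose degree
  -- is `⊥`.
  have hm0 : 0 < m := by
    rcases Nat.eq_zero_or_pos m with rfl | hpos
    · obtain ⟨c, rfl⟩ : ∃ c, h = Polynomial.C c :=
        ⟨_, Polynomial.eq_C_of_degree_le_zero (by rw [hm]; exact le_rfl)⟩
      rw [Polynomial.eval_C] at hh0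
      rw [hh0, Polynomial.C_0, Polynomial.degree_zero] at hm
      exact absurd hm (by simp)
    · exact hpos
  have hc := constantCoeff_coe_eq_zero hh0
  have hneg := constantCoeff_neg_eq_zero hc
  have hcoe : IsConvergentSeries (h : PowerSeries ℂ) := by
    have := (isConvergentSeries_pX_pow 1).aeval h
    rwa [← psubst_X_pow_coe one_pos, pow_one, PowerSeries.X_subst] at this
  have hord := hpr.hasYOrder.subst_shift hneg
  have hPc : IsConvergentSeries (MvPowerSeries.subst ![varX, varY + inX (-(h : PowerSeries ℂ))]
      (p : MvPowerSeries (Fin 2) ℂ)) := IsConvergentSeries.subst_shift p.2 hcoe.neg hneg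
  have hroots := hasLeadingPart_iff_puiseuxRootsOrderGT (p := p) (m := m) hh0
  have hnewton := hroots.trans
    ⟨NewtonPolygonAbove.of_puiseuxRootsOrderGT hPc hord, fun H => H.puiseuxRootsOrderGT hord⟩
  have hN1 : MvPowerSeries.coeff (Finsupp.single 1 1) (normalizedYDeriv p (k + 1)) ≠ 0 := by
    rw [hpr.coeff_normalizedYDeriv]
    exact one_ne_zero
  obtain ⟨g, hg, hg0, hgroot⟩ := exists_implicit (isConvergentSeries_normalizedYDeriv p (k + 1))
    hpr.constantCoeff_normalizedYDeriv hN1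
  have hψ : (∀ (n : ℕ) (φ : PowerSeries ℂ), IsPuiseuxFactor p n φ → HasLeadingPart h m n φ) →
      IsConvergentSeries (-g - (h : PowerSeries ℂ)) ∧
        (PowerSeries.X : PowerSeries ℂ) ^ (m + 1) ∣ -g - (h : PowerSeries ℂ) := by
    intro H
    refine ⟨hg.neg.sub hcoe, ?_⟩
    have h1 := (hnewton.1 H).X_pow_dvd_root hpr hneg hg0 hgroot
    rw [← dvd_neg] at h1
    convert h1 using 1
    ring
  refine ⟨fun hp ⟨n, φ, hφ, hlead⟩ n' φ' hφ' => hlead.of_irreducible hp hφ hφ',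
    hnewton.trans (newtonPolygonAbove_iff_exists_expansion hpr hm0 hh0),
    ⟨hpr.constantCoeff_normalizedYDeriv, by rwa [constantCoeff_pderiv], g, ⟨hg, hg0, hgroot⟩,
      fun g' hg'0 hg' => implicit_unique hN1 hg'0 hg0 hg' hgroot,
      fun H => ⟨-g - (h : PowerSeries ℂ), (hψ H).1, (hψ H).2, by ring⟩⟩, fun hW H => ?_⟩
  refine ⟨-g - (h : PowerSeries ℂ), (hψ H).1, (hψ H).2, ?_⟩
  obtain ⟨s, hs⟩ := hW.normalizedYDeriv_eq hpr
  -- The derivative `y + s(x)` vanishes at `y = g(x)`, so the higher terms in (4) are the same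
  -- series `-g - h` as in (3).
  have hgs : g + s = 0 := by
    rw [← psubst_varY_add_inX hg0, ← hs, hgroot]
  have hs' : s = (h : PowerSeries ℂ) + (-g - (h : PowerSeries ℂ)) := by
    linear_combination hgs
  have hadd : inX ((h : PowerSeries ℂ) + (-g - (h : PowerSeries ℂ))) =
      inX (h : PowerSeries ℂ) + inX (-g - (h : PowerSeries ℂ)) :=
    PowerSeries.subst_add (PowerSeries.HasSubst.X 0) _ _
  rw [hs, hs', hadd, inX_coe, add_assoc]
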